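/- **Stratification of $B_2(K_4)$.** For a configuration $P=(p_1,p_2,p_3,p_4)\in(\mathbb R^2)^4$ let $W(K_4,P)$ be the linear space of self-stresses, i.e. of real numbers $w_{i,j}=w_{j,i}$ ($1\le i\ne j\le 4$) with $\sum_{j\ne i}w_{i,j}(p_j-p_i)=0$ for every $i$. Call $W(K_4,P)$ and $W(K_4,Q)$ equivalent if there is a homeomorphism $\xi:W(K_4,P)\to W(K_4,Q)$ such that $\operatorname{sgn}(\xi(w)_{i,j})=\operatorname{sgn}(w_{i,j})$ for all $w$ and all $i\ne j$. A stratum of $B_2(K_4)=(\mathbb R^2)^4$ is a maximal connected set of configurations with pairwise equivalent fibers $W(K_4,P)$. The strata are as follows. Each of the following sets of configurations is a union of strata, every configuration belongs to exactly one of them, and each set consists of the stated number of strata, all of the stated dimension. - No three points on a line: 14 strata of dimension 8; the fibers have dimension 1. - Four distinct points, exactly three of them on a line: 24 strata of dimension 7 (six for each choice of the three points); the fibers have dimension 1. - Four distinct points on a line: 12 strata of dimension 6; the fibers have dimension 3. - Exactly two points coincide, and the points are not all on a line: 12 strata of dimension 6; the fibers have dimension 1. - Four points on a line, exactly two of which coincide: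 18 strata of dimension 5, in 6 of which the double point is in the middle (strictly between the other two points) and in 12 of which it is not; the fibers have dimension 3. - Exactly three points coincide: 4 strata of dimension 4; the fibers have dimension 3. - Two pairs of points coincide, at two different positions: 3 strata of dimension 4; the fibers have dimension 3. - All four points coincide: 1 stratum of dimension 2; the fibers have dimension 6. In particular the numbers of strata of dimension $0,1,2,3,4,5,6,7,8$ are $0,0,1,0,7,18,24,24,14$. -/

import Mathlib

open scoped ENNReal

namespace Tensegrity

/-- A configuration: labelled points `P v` (`v ∈ V`) in Euclidean space `ℝ^d`. The set of all
configurations is the base `B_d(G) = (ℝ^d)^n` for every graph `G` on `V`. -/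
abbrev Configuration (V : Type*) (d : ℕ) : Type _ := V → EuclideanSpace ℝ (Fin d)

/-- The linear fiber `W(G, P)`: the space of self-stresses of the framework `G(P)`, that is, of
symmetric families `w i j`, zero where there is no edge (in particular on the diagonal), with
`∑_j w i j (p_j - p_i) = 0` at every vertex `i`. -/
def selfStress {V : Type*} [Fintype V] {d : ℕ} (G : SimpleGraph V) (P : Configuration V d) :
    Submodule ℝ (V → V → ℝ) where
  carrier := {w | (∀ i j, w i j = w j i) ∧ (∀ i j, ¬ G.Adj i j → w i j = 0) ∧
    ∀ i, ∑ j, w i j • (P j - P i) = 0}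
  add_mem' := by
    rintro a b ⟨ha, ha', ha''⟩ ⟨hb, hb', hb''⟩
    refine ⟨fun i j => ?_, fun i j h => ?_, fun i => ?_⟩
    · simp [ha i j, hb i j]
    · simp [ha' i j h, hb' i j h]
    · simp [add_smul, Finset.sum_add_distrib, ha'' i, hb'' i]
  zero_mem' := by simp
  smul_mem' := by
    rintro c a ⟨ha, ha', ha''⟩
    refine ⟨fun i j => ?_, fun i j h => ?_, fun i => ?_⟩
    · simp [ha i j]
    · simp [ha' i j h]
    · simp [mul_smul, ← Finset.smul_sum, ha'' i]

/-- Two fibers are equivalent if there is a homeomorphism between them that preserves the sign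
of the stress on every edge. -/
def FiberEquiv {V : Type*} [Fintype V] {d : ℕ} (G : SimpleGraph V)
    (P Q : Configuration V d) : Prop :=
  ∃ ξ : selfStress G P ≃ₜ selfStress G Q, ∀ (w : selfStress G P) (i j : V),
    SignType.sign ((ξ w : V → V → ℝ) i j) = SignType.sign ((w : V → V → ℝ) i j)

/-- A stratum of `B_d(G)`: a maximal connected set of configurations with pairwise equivalent
fibers. -/
def IsStratum {V : Type*} [Fintype V] {d : ℕ} (G : SimpleGraph V)
    (S : Set (Configuration V d)) : Prop :=
  Maximal (fun A : Set (Configuration V d) =>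
    IsConnected A ∧ ∀ P ∈ A, ∀ Q ∈ A, FiberEquiv G P Q) S

/-- The dimension of a subset of `B_d(G)`. Strata are semialgebraic, and the dimension of a
semialgebraic set is its Hausdorff dimension. -/
noncomputable def stratumDim {V : Type*} [Fintype V] {d : ℕ}
    (S : Set (Configuration V d)) : ℝ≥0∞ := dimH S

/-- The possible geometric types of four labelled points in the plane. -/
inductive PointPattern
  | generalPosition
  | threeCollinear
  | fourCollinear
  | onePairCoincides
  | collinearDoubleInMiddle
  | collinearDoubleAtEnd
  | threeCoincide
  | twoPairsCoincide
  | allCoincide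

/-- Four distinct points, not all on a line, such that the three points other than the one
labelled `l` are on a line. -/
def collinearTriple (l : Fin 4) : Set (Configuration (Fin 4) 2) :=
  {P | Function.Injective P ∧ Collinear ℝ (P '' {l}ᶜ) ∧ ¬ Collinear ℝ (Set.range P)}

/-- The set of configurations of four points in the plane of a given geometric type. In the
cases with labels `i j k l`, these are the four labels in some order `σ`. -/
def PointPattern.locus : PointPattern → Set (Configuration (Fin 4) 2)
  | .generalPosition => {P | ∀ i j k : Fin 4, i ≠ j → j ≠ k → i ≠ k →
      ¬ Collinear ℝ {P i, P j, P k}}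
  | .threeCollinear => ⋃ l : Fin 4, collinearTriple l
  | .fourCollinear => {P | Function.Injective P ∧ Collinear ℝ (Set.range P)}
  | .onePairCoincides => {P | (∃ i j : Fin 4, i ≠ j ∧ P i = P j) ∧ ¬ Collinear ℝ (Set.range P)}
  | .collinearDoubleInMiddle => {P | ∃ σ : Equiv.Perm (Fin 4),
      P (σ 0) = P (σ 1) ∧ Sbtw ℝ (P (σ 2)) (P (σ 0)) (P (σ 3))}
  | .collinearDoubleAtEnd => {P | ∃ σ : Equiv.Perm (Fin 4),
      P (σ 0) = P (σ 1) ∧ Sbtw ℝ (P (σ 0)) (P (σ 2)) (P (σ 3))}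
  | .threeCoincide => {P | ∃ σ : Equiv.Perm (Fin 4),
      P (σ 0) = P (σ 1) ∧ P (σ 1) = P (σ 2) ∧ P (σ 2) ≠ P (σ 3)}
  | .twoPairsCoincide => {P | ∃ σ : Equiv.Perm (Fin 4),
      P (σ 0) = P (σ 1) ∧ P (σ 2) = P (σ 3) ∧ P (σ 1) ≠ P (σ 2)}
  | .allCoincide => {P | ∀ i j : Fin 4, P i = P j}

/-- The set `T` of configurations is a union of strata of `B_2(K_4)`; it consists of exactly
`N` strata, each of them of dimension `k`, and over each of its points the fiber has
dimension `f`. -/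
def ConsistsOfStrata (T : Set (Configuration (Fin 4) 2)) (N k f : ℕ) : Prop :=
  (∀ S : Set (Configuration (Fin 4) 2), IsStratum (⊤ : SimpleGraph (Fin 4)) S →
    (S ∩ T).Nonempty → S ⊆ T) ∧
  (∀ P ∈ T, ∃ S : Set (Configuration (Fin 4) 2),
    IsStratum (⊤ : SimpleGraph (Fin 4)) S ∧ P ∈ S) ∧
  {S : Set (Configuration (Fin 4) 2) | IsStratum (⊤ : SimpleGraph (Fin 4)) S ∧ S ⊆ T}.encard = N ∧
  (∀ S : Set (Configuration (Fin 4) 2), IsStratum (⊤ : SimpleGraph (Fin 4)) S → S ⊆ T →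
    stratumDim S = k) ∧
  (∀ P ∈ T, Module.finrank ℝ (selfStress (⊤ : SimpleGraph (Fin 4)) P) = f)

end Tensegrity

/-! Four plane points that are not collinear have exactly one affine dependency `a` up to scaling,
the vector of signed triangle areas `affDep`. Filling the diagonal of a self-stress with minus its
row sums turns every row into an affine dependency, so by symmetry the stress is a multiple of `a i
* a j` off the diagonal. The fiber is therefore a line, and the signs on it determine the sign
vector of `a` up to a common sign. Conversely, equal sign vectors give equivalent fibers, by
rescaling the edge `i j` with a product of vertex factors.

For collinear points with coordinates `x`, a stress is a choice of six edge weights whose forces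
balance at every point. The resultant forces fill the three-dimensional space of vectors of sum zero
unless all points coincide, so the fiber has dimension 3, or 6 when all coincide. Its sign patterns
reveal which points coincide (an edge can carry stress alone) and which point of a triple is in the
middle (stresses on three points), hence the order along the line up to reversal. Conversely, equal
orders give equivalent fibers, by rescaling each edge by a ratio of lengths.

This suggests labels: sign vectors taking both signs, and weak orders of the four points with one
orientation chosen. Each label set is connected, being a continuous image of a product of connected
sets, and has equivalent fibers. A connected set with equivalent fibers cannot leave a label set: in
the collinear case the fiber fixes the label, and otherwise no entry of `a` can change sign without
vanishing, while the zero pattern of `a` is fixed by the fiber. Hence the strata are exactly the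
label sets (`isStratum_iff`).

The same parametrizations have `C¹` inverses and open domains once redundant parameters are removed.
They give dimension 4 plus the number of nonzero entries of a sign vector, dimension `m + 2` for `m
≥ 2` positions on a line, and dimension 2 for a single position. Geometric types and the counts then
become finite checks on labels. -/

namespace Tensegrity

/-! ### Affine dependencies of four points in the plane -/

/-- The determinant of two plane vectors. -/
def cross (u v : EuclideanSpace ℝ (Fin 2)) : ℝ := u 0 * v 1 - u 1 * v 0

/-- The standard affine dependency of four points in the plane: the signed areas of the four
triangles. -/
def affDep (P : Configuration (Fin 4) 2) : Fin 4 → ℝ :=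
  ![cross (P 2 - P 1) (P 3 - P 1), -cross (P 2 - P 0) (P 3 - P 0),
    cross (P 1 - P 0) (P 3 - P 0), -cross (P 1 - P 0) (P 2 - P 0)]

theorem sum_affDep (P : Configuration (Fin 4) 2) : ∑ i, affDep P i = 0 := by
  simp [Fin.sum_univ_four, affDep, cross]; ring

theorem sum_affDep_smul (P : Configuration (Fin 4) 2) : ∑ i, affDep P i • P i = 0 := by
  ext t
  fin_cases t <;> simp [Fin.sum_univ_four, affDep, cross] <;> ring

/-- Every affine dependency is proportional to the standard one. -/
theorem mul_affDep_comm {P : Configuration (Fin 4) 2} {c : Fin 4 → ℝ} (h0 : ∑ i, c i = 0)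
    (h1 : ∑ i, c i • P i = 0) (i k : Fin 4) : c i * affDep P k = c k * affDep P i := by
  have hx := congrArg (fun v : EuclideanSpace ℝ (Fin 2) => v 0) h1
  have hy := congrArg (fun v : EuclideanSpace ℝ (Fin 2) => v 1) h1
  simp only [Fin.sum_univ_four, PiLp.add_apply, PiLp.smul_apply, smul_eq_mul,
    PiLp.zero_apply] at h0 hx hy
  -- What remains is `∑ c i • (P i - P 3) = 0` over the first three indices; taking determinants
  -- with each difference `P i - P 3` gives the proportionality to the minors.
  have h0' : c 3 = -(c 0 + c 1 + c 2) := by linarith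
  rw [h0'] at hx hy
  fin_cases i <;> fin_cases k <;> simp [affDep, cross, h0'] <;> grind

theorem continuous_affDep : Continuous affDep := by
  refine continuous_pi fun i => ?_
  fin_cases i <;> simp only [affDep, cross] <;> simp <;> fun_prop

theorem contDiff_affDep (i : Fin 4) : ContDiff ℝ 1 (fun P => affDep P i) := by
  fin_cases i <;> simp only [affDep, cross] <;> simp <;> fun_prop

/-- A set of plane points is collinear iff all triangles at one of its points are degenerate. -/
theorem collinear_iff_cross {S : Set (EuclideanSpace ℝ (Fin 2))} {A : EuclideanSpace ℝ (Fin 2)}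
    (hA : A ∈ S) : Collinear ℝ S ↔ ∀ B ∈ S, ∀ C ∈ S, cross (B - A) (C - A) = 0 := by
  constructor
  · intro h B hB C hC
    obtain ⟨v, hv⟩ := (collinear_iff_of_mem hA).1 h
    obtain ⟨r, rfl⟩ := hv B hB
    obtain ⟨t, rfl⟩ := hv C hC
    simp [cross]; ring
  · intro h
    by_cases hS : ∀ B ∈ S, B = A
    · exact (collinear_iff_of_mem hA).2 ⟨0, fun p hp => ⟨0, by simp [hS p hp]⟩⟩
    · push Not at hS
      obtain ⟨B, hB, hBA⟩ := hS
      refine (collinear_iff_of_mem hA).2 ⟨B - A, fun C hC => ?_⟩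
      have hc := h B hB C hC
      have hn : (B 0 - A 0) ^ 2 + (B 1 - A 1) ^ 2 ≠ 0 := by
        intro h0
        apply hBA
        ext t
        fin_cases t <;> simp <;> nlinarith [sq_nonneg (B 0 - A 0), sq_nonneg (B 1 - A 1)]
      -- The coefficient of the orthogonal projection of `C - A` to the line spanned by `B - A`.
      refine ⟨((B 0 - A 0) * (C 0 - A 0) + (B 1 - A 1) * (C 1 - A 1)) /
        ((B 0 - A 0) ^ 2 + (B 1 - A 1) ^ 2), ?_⟩
      simp only [cross, PiLp.sub_apply] at hc
      ext t
      fin_cases t <;> simp <;> field_simp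
      · linear_combination (-(B 1 - A 1)) * hc
      · linear_combination (B 0 - A 0) * hc

theorem collinear_range_iff (P : Configuration (Fin 4) 2) :
    Collinear ℝ (Set.range P) ↔ affDep P = 0 := by
  rw [collinear_iff_cross (Set.mem_range_self 0)]
  simp only [Set.forall_mem_range]
  constructor
  · intro h
    have h1 := h 1 2
    have h2 := h 1 3
    have h3 := h 2 3
    ext i
    fin_cases i <;> simp [affDep, cross] at * <;> linarith
  · intro h i j
    have h1 := congrFun h 1
    have h2 := congrFun h 2
    have h3 := congrFun h 3
    simp [affDep, cross] at h1 h2 h3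
    fin_cases i <;> fin_cases j <;> simp [cross] <;> linarith

theorem collinear_image_compl_iff (P : Configuration (Fin 4) 2) (l : Fin 4) :
    Collinear ℝ (P '' {l}ᶜ) ↔ affDep P l = 0 := by
  have key : ∀ a b c : Fin 4, ({l}ᶜ : Set (Fin 4)) = {a, b, c} →
      (Collinear ℝ (P '' {l}ᶜ) ↔ cross (P b - P a) (P c - P a) = 0) := by
    intro a b c h
    rw [h, Set.image_insert_eq, Set.image_pair, collinear_iff_cross (Set.mem_insert _ _)]
    constructor
    · intro h; exact h _ (by simp) _ (by simp)
    · intro h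
      simp only [cross, PiLp.sub_apply] at h
      simp only [Set.mem_insert_iff, Set.mem_singleton_iff]
      rintro B (rfl | rfl | rfl) C (rfl | rfl | rfl) <;> simp [cross] <;> linarith
  fin_cases l
  · exact key 1 2 3 (by ext x; fin_cases x <;> simp)
  · simpa [affDep] using key 0 2 3 (by ext x; fin_cases x <;> simp)
  · simpa [affDep] using key 0 1 3 (by ext x; fin_cases x <;> simp)
  · simpa [affDep] using key 0 1 2 (by ext x; fin_cases x <;> simp)

/-- Coinciding points give the affine dependency `e_i - e_j`, and `affDep P` is proportional to it.
-/
theorem affDep_eq_zero_of_eq {P : Configuration (Fin 4) 2} {i j k : Fin 4} (hij : i ≠ j)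
    (h : P i = P j) (hki : k ≠ i) (hkj : k ≠ j) : affDep P k = 0 := by
  have := mul_affDep_comm (P := P) (c := Pi.single i 1 - Pi.single j 1) (by simp)
    (by simp [sub_smul, Pi.single_apply, h]) i k
  simpa [hij, hki, hkj] using this

/-- A nonzero dependency supported on two indices reads `c • (P i - P j) = 0` with `c ≠ 0`. -/
theorem eq_of_affDep_eq_zero {P : Configuration (Fin 4) 2} (hP : affDep P ≠ 0) {i j : Fin 4}
    (hij : i ≠ j) (h : ∀ k, k ≠ i → k ≠ j → affDep P k = 0) : P i = P j := by
  have h0 := sum_affDep P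
  have h1 := sum_affDep_smul P
  rw [← Finset.sum_subset (Finset.subset_univ {i, j}), Finset.sum_pair hij] at h0 h1
  · have hj : affDep P j = -affDep P i := by linarith
    rw [hj, neg_smul, ← sub_eq_add_neg, ← smul_sub, smul_eq_zero] at h1
    rcases h1 with h1 | h1
    · refine absurd (funext fun k => ?_) hP
      by_cases hki : k = i
      · simp [hki, h1]
      by_cases hkj : k = j
      · simp [hkj, hj, h1]
      · exact h k hki hkj
    · exact sub_eq_zero.1 h1
  · intro k _ hk
    simp only [Finset.mem_insert, Finset.mem_singleton, not_or] at hk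
    simp [h k hk.1 hk.2]
  · intro k _ hk
    simp only [Finset.mem_insert, Finset.mem_singleton, not_or] at hk
    exact h k hk.1 hk.2

/-! ### Self-stresses and equivalence of fibers -/

theorem mem_selfStress_top {V : Type*} [Fintype V] {d : ℕ} {P : Configuration V d}
    {w : V → V → ℝ} : w ∈ selfStress (⊤ : SimpleGraph V) P ↔
      (∀ i j, w i j = w j i) ∧ (∀ i, w i i = 0) ∧ ∀ i, ∑ j, w i j • (P j - P i) = 0 := by
  constructor
  · rintro ⟨h1, h2, h3⟩
    exact ⟨h1, fun i => h2 i i (by simp), h3⟩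
  · rintro ⟨h1, h2, h3⟩
    exact ⟨h1, fun i j hij => by
      have : i = j := by simpa using hij
      exact this ▸ h2 i, h3⟩

theorem FiberEquiv.refl {V : Type*} [Fintype V] {d : ℕ} (G : SimpleGraph V)
    (P : Configuration V d) : FiberEquiv G P P := ⟨Homeomorph.refl _, fun _ _ _ => rfl⟩

theorem FiberEquiv.symm {V : Type*} [Fintype V] {d : ℕ} {G : SimpleGraph V}
    {P Q : Configuration V d} (h : FiberEquiv G P Q) : FiberEquiv G Q P := by
  obtain ⟨ξ, hξ⟩ := h
  exact ⟨ξ.symm, fun w i j => by simpa using (hξ (ξ.symm w) i j).symm⟩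

/-- Equivalent fibers realize the same sign patterns. -/
theorem FiberEquiv.exists_sign_eq {V : Type*} [Fintype V] {d : ℕ} {G : SimpleGraph V}
    {P Q : Configuration V d} (h : FiberEquiv G P Q) {w : V → V → ℝ} (hw : w ∈ selfStress G P) :
    ∃ w' ∈ selfStress G Q, ∀ i j, SignType.sign (w' i j) = SignType.sign (w i j) := by
  obtain ⟨ξ, hξ⟩ := h
  exact ⟨ξ ⟨w, hw⟩, (ξ ⟨w, hw⟩).2, hξ ⟨w, hw⟩⟩

/-- Rescaling every edge by a positive factor gives an equivalence of fibers. -/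
theorem FiberEquiv.of_scaling {V : Type*} [Fintype V] {d : ℕ} {G : SimpleGraph V}
    {P Q : Configuration V d} (ρ : V → V → ℝ) (hρ : ∀ i j, 0 < ρ i j)
    (h : ∀ w ∈ selfStress G P, (fun i j => ρ i j * w i j) ∈ selfStress G Q)
    (h' : ∀ w ∈ selfStress G Q, (fun i j => (ρ i j)⁻¹ * w i j) ∈ selfStress G P) :
    FiberEquiv G P Q := by
  refine ⟨{ toFun := fun w => ⟨_, h _ w.2⟩, invFun := fun w => ⟨_, h' _ w.2⟩,
            left_inv := fun w => ?_, right_inv := fun w => ?_,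
            continuous_toFun := ?_, continuous_invFun := ?_ }, fun w i j => ?_⟩
  · ext i j; simp [(hρ i j).ne']
  · ext i j; simp [(hρ i j).ne']
  · refine Continuous.subtype_mk ?_ _
    refine continuous_pi fun i => continuous_pi fun j => ?_
    exact continuous_const.mul
      ((continuous_apply j).comp ((continuous_apply i).comp continuous_subtype_val))
  · refine Continuous.subtype_mk ?_ _
    refine continuous_pi fun i => continuous_pi fun j => ?_
    exact continuous_const.mul
      ((continuous_apply j).comp ((continuous_apply i).comp continuous_subtype_val))
  · change SignType.sign (ρ i j * _) = _
    rw [sign_mul, sign_pos (hρ i j), one_mul]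

/-! ### The fiber over a configuration that is not collinear -/

/-- The stress `a i * a j` defined by the affine dependency `a`. -/
def depStress (a : Fin 4 → ℝ) (i j : Fin 4) : ℝ := if i = j then 0 else a i * a j

theorem depStress_mem (P : Configuration (Fin 4) 2) :
    depStress (affDep P) ∈ selfStress (⊤ : SimpleGraph (Fin 4)) P := by
  rw [mem_selfStress_top]
  refine ⟨fun i j => ?_, fun i => by simp [depStress], fun i => ?_⟩
  · by_cases h : i = j
    · simp [h]
    · simp [depStress, h, Ne.symm h, mul_comm]
  · have : ∀ j, depStress (affDep P) i j • (P j - P i) =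
        affDep P i • (affDep P j • P j - affDep P j • P i) := by
      intro j
      by_cases h : i = j
      · simp [h]
      · simp [depStress, h, mul_smul, smul_sub]
    rw [Finset.sum_congr rfl fun j _ => this j, ← Finset.smul_sum, Finset.sum_sub_distrib,
      ← Finset.sum_smul, sum_affDep, sum_affDep_smul]
    simp

theorem exists_eq_smul_depStress {P : Configuration (Fin 4) 2} (hP : affDep P ≠ 0)
    {w : Fin 4 → Fin 4 → ℝ} (hw : w ∈ selfStress (⊤ : SimpleGraph (Fin 4)) P) :
    ∃ c : ℝ, w = c • depStress (affDep P) := by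
  obtain ⟨h1, h2, h3⟩ := mem_selfStress_top.1 hw
  obtain ⟨k, hk⟩ := Function.ne_iff.1 hP
  simp only [Pi.zero_apply] at hk
  set a := affDep P with ha
  -- The diagonal makes all row sums vanish, so equilibrium at `i` says that row `i` is an affine
  -- dependency. A symmetric matrix all of whose rows are proportional to `a` is a multiple of `a i
  -- * a j`.
  let u : Fin 4 → Fin 4 → ℝ := fun i j => w i j - if i = j then ∑ l, w i l else 0
  have hu : ∀ i j l, u i j * a l = u i l * a j := by
    intro i j l
    refine mul_affDep_comm ?_ ?_ j l
    · simp [u, Finset.sum_sub_distrib]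
    · have := h3 i
      simp only [smul_sub, Finset.sum_sub_distrib, ← Finset.sum_smul] at this
      simpa [u, sub_smul, Finset.sum_sub_distrib, ite_smul] using this
  have hs : ∀ i j, u i j = u j i := by
    intro i j
    by_cases h : i = j
    · rw [h]
    · simp [u, h, Ne.symm h, h1 i j]
  refine ⟨u k k / (a k * a k), ?_⟩
  ext i j
  by_cases hij : i = j
  · simp [hij, h2, depStress]
  have hw' : w i j = u i j := by simp [u, hij]
  have e1 := hu i j k
  have e2 := hu k i k
  rw [hs k i] at e2
  simp only [Pi.smul_apply, smul_eq_mul, depStress, hij, if_false, hw']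
  field_simp
  linear_combination a k * e1 + a j * e2

theorem smul_depStress_mem (P : Configuration (Fin 4) 2) (c : ℝ) :
    c • depStress (affDep P) ∈ selfStress (⊤ : SimpleGraph (Fin 4)) P :=
  Submodule.smul_mem _ _ (depStress_mem P)

/-- A nonzero affine dependency has two nonzero entries. -/
theorem exists_mul_ne_zero {a : Fin 4 → ℝ} (h0 : ∑ i, a i = 0) (ha : a ≠ 0) :
    ∃ i j, i ≠ j ∧ a i * a j ≠ 0 := by
  obtain ⟨i, hi⟩ := Function.ne_iff.1 ha
  simp only [Pi.zero_apply] at hi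
  by_contra! h
  refine hi ?_
  rw [← h0]
  refine (Finset.sum_eq_single i (fun j _ hj => ?_) (by simp)).symm
  exact (mul_eq_zero.1 (h i j hj.symm)).resolve_left hi

theorem finrank_selfStress_of_not_collinear {P : Configuration (Fin 4) 2} (hP : affDep P ≠ 0) :
    Module.finrank ℝ (selfStress (⊤ : SimpleGraph (Fin 4)) P) = 1 := by
  have : selfStress (⊤ : SimpleGraph (Fin 4)) P = Submodule.span ℝ {depStress (affDep P)} := by
    ext w
    rw [Submodule.mem_span_singleton]
    constructor
    · intro hw
      obtain ⟨c, hc⟩ := exists_eq_smul_depStress hP hw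
      exact ⟨c, hc.symm⟩
    · rintro ⟨c, rfl⟩
      exact smul_depStress_mem P c
  rw [this]
  refine finrank_span_singleton ?_
  obtain ⟨i, j, hij, h⟩ := exists_mul_ne_zero (sum_affDep P) hP
  intro h0
  apply h
  simpa [depStress, hij] using congrFun (congrFun h0 i) j

/-- Both fibers are lines spanned by products `a i * a j`, so scaling the edge `i j` by `ρ i * ρ j`
with `ρ i` the ratio of the entries of the two dependencies carries one generator to the other. -/
theorem fiberEquiv_of_sign_affDep {P Q : Configuration (Fin 4) 2} (hP : affDep P ≠ 0)
    (hQ : affDep Q ≠ 0)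
    (h : ∀ i, SignType.sign (affDep P i) = SignType.sign (affDep Q i)) :
    FiberEquiv (⊤ : SimpleGraph (Fin 4)) P Q := by
  have hz : ∀ i, affDep P i = 0 ↔ affDep Q i = 0 := fun i => by
    rw [← sign_eq_zero_iff, h, sign_eq_zero_iff]
  have hpos : ∀ i, affDep P i ≠ 0 → 0 < affDep Q i / affDep P i := by
    intro i hi
    rw [← sign_eq_one_iff, div_eq_mul_inv, sign_mul, ← h i]
    rcases lt_or_gt_of_ne hi with h' | h'
    · rw [sign_neg h', sign_neg (inv_lt_zero.2 h')]; rfl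
    · rw [sign_pos h', sign_pos (inv_pos.2 h')]; rfl
  -- Where both dependencies vanish any positive factor works.
  let ρ : Fin 4 → ℝ := fun i => if affDep P i = 0 then 1 else affDep Q i / affDep P i
  have hρ : ∀ i, 0 < ρ i := by
    intro i
    by_cases hi : affDep P i = 0
    · simp [ρ, hi]
    · simpa [ρ, hi] using hpos i hi
  have hmul : ∀ i, ρ i * affDep P i = affDep Q i := by
    intro i
    by_cases hi : affDep P i = 0
    · simp [hi, (hz i).1 hi]
    · simp [ρ, hi]
  refine FiberEquiv.of_scaling (fun i j => ρ i * ρ j) (fun i j => mul_pos (hρ i) (hρ j)) ?_ ?_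
  · intro w hw
    obtain ⟨c, rfl⟩ := exists_eq_smul_depStress hP hw
    convert smul_depStress_mem Q c using 1
    ext i j
    by_cases hij : i = j
    · simp [depStress, hij]
    · simp only [depStress, Pi.smul_apply, smul_eq_mul, hij, if_false, ← hmul]; ring
  · intro w hw
    obtain ⟨c, rfl⟩ := exists_eq_smul_depStress hQ hw
    convert smul_depStress_mem P c using 1
    ext i j
    by_cases hij : i = j
    · simp [depStress, hij]
    · have := (hρ i).ne'
      have := (hρ j).ne'
      simp only [depStress, Pi.smul_apply, smul_eq_mul, hij, if_false, ← hmul]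
      field_simp

/-- If the fibers over two non-collinear configurations are equivalent, the signs of the stresses
of the two affine dependencies agree up to a common sign. -/
theorem FiberEquiv.exists_sign_mul_eq {P Q : Configuration (Fin 4) 2}
    (h : FiberEquiv (⊤ : SimpleGraph (Fin 4)) P Q) (hQ : affDep Q ≠ 0) :
    ∃ ε : SignType, ∀ i j, i ≠ j →
      SignType.sign (affDep P i) * SignType.sign (affDep P j) =
        ε * (SignType.sign (affDep Q i) * SignType.sign (affDep Q j)) := by
  obtain ⟨w, hw, hs⟩ := h.exists_sign_eq (depStress_mem P)
  obtain ⟨c, rfl⟩ := exists_eq_smul_depStress hQ hw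
  refine ⟨SignType.sign c, fun i j hij => ?_⟩
  simpa [depStress, hij, sign_mul] using (hs i j).symm

/-! ### The fiber over a collinear configuration -/

/-- The configuration of the points with coordinates `x i` on the line through `p` with
direction `v`. -/
def lineConfig (p v : EuclideanSpace ℝ (Fin 2)) (x : Fin 4 → ℝ) : Configuration (Fin 4) 2 :=
  fun i => p + x i • v

theorem affDep_lineConfig (p v : EuclideanSpace ℝ (Fin 2)) (x : Fin 4 → ℝ) :
    affDep (lineConfig p v x) = 0 := by
  ext i
  fin_cases i <;> simp [affDep, cross, lineConfig] <;> ring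

theorem exists_eq_lineConfig {P : Configuration (Fin 4) 2} (h : affDep P = 0) :
    ∃ p v x, v ≠ 0 ∧ P = lineConfig p v x := by
  obtain ⟨p, v, hv⟩ := (collinear_iff_exists_forall_eq_smul_vadd _).1
    ((collinear_range_iff P).2 h)
  choose x hx using fun i => hv (P i) (Set.mem_range_self i)
  -- With zero direction all points coincide; any nonzero direction with all coordinates zero
  -- describes them as well.
  by_cases h0 : v = 0
  · obtain ⟨u, hu⟩ := exists_ne (0 : EuclideanSpace ℝ (Fin 2))
    exact ⟨p, u, 0, hu, funext fun i => by rw [hx i]; simp [h0, lineConfig]⟩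
  · exact ⟨p, v, x, h0, funext fun i => by rw [hx i, vadd_eq_add, add_comm]; rfl⟩

theorem lineConfig_apply_eq_iff {p v : EuclideanSpace ℝ (Fin 2)} (hv : v ≠ 0) (x : Fin 4 → ℝ)
    (i j : Fin 4) : lineConfig p v x i = lineConfig p v x j ↔ x i = x j := by
  simp [lineConfig, hv]

theorem mem_selfStress_lineConfig {p v : EuclideanSpace ℝ (Fin 2)} (hv : v ≠ 0)
    {x : Fin 4 → ℝ} {w : Fin 4 → Fin 4 → ℝ} :
    w ∈ selfStress (⊤ : SimpleGraph (Fin 4)) (lineConfig p v x) ↔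
      (∀ i j, w i j = w j i) ∧ (∀ i, w i i = 0) ∧ ∀ i, ∑ j, w i j * (x j - x i) = 0 := by
  rw [mem_selfStress_top]
  have : ∀ i, ∑ j, w i j • (lineConfig p v x j - lineConfig p v x i) =
      (∑ j, w i j * (x j - x i)) • v := by
    intro i
    rw [Finset.sum_smul]
    refine Finset.sum_congr rfl fun j _ => ?_
    rw [mul_smul, sub_smul]
    simp [lineConfig]
  simp only [this, smul_eq_zero, hv, or_false]

/-- The unit stress on the edge `a b`. -/
def edgeStress (a b i j : Fin 4) : ℝ := if (i = a ∧ j = b) ∨ (i = b ∧ j = a) then 1 else 0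

theorem edgeStress_comm (a b i j : Fin 4) : edgeStress a b i j = edgeStress a b j i := by
  unfold edgeStress
  congr 1
  simp only [eq_iff_iff]
  tauto

theorem edgeStress_self {a b : Fin 4} (h : a ≠ b) (i : Fin 4) : edgeStress a b i i = 0 := by
  unfold edgeStress
  rw [if_neg]
  rintro (⟨rfl, rfl⟩ | ⟨rfl, rfl⟩) <;> exact h rfl

theorem edgeStress_mem {P : Configuration (Fin 4) 2} {a b : Fin 4} (hab : a ≠ b)
    (h : P a = P b) : edgeStress a b ∈ selfStress (⊤ : SimpleGraph (Fin 4)) P := by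
  refine mem_selfStress_top.2 ⟨edgeStress_comm a b, edgeStress_self hab, fun i => ?_⟩
  refine Finset.sum_eq_zero fun j _ => ?_
  unfold edgeStress
  split_ifs with hij
  · rcases hij with ⟨rfl, rfl⟩ | ⟨rfl, rfl⟩ <;> simp [h]
  · simp

/-- A single stressed edge at `a` can be in equilibrium only if it has length zero. -/
theorem eq_of_support_edge {P : Configuration (Fin 4) 2} {w : Fin 4 → Fin 4 → ℝ}
    (hw : w ∈ selfStress (⊤ : SimpleGraph (Fin 4)) P) {a b : Fin 4} (h : w a b ≠ 0)
    (h' : ∀ j, j ≠ b → w a j = 0) : P a = P b := by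
  obtain ⟨-, -, h3⟩ := mem_selfStress_top.1 hw
  have := h3 a
  rw [Finset.sum_eq_single b (fun j _ hj => by simp [h' j hj]) (by simp), smul_eq_zero] at this
  exact (sub_eq_zero.1 (this.resolve_left h)).symm

/-- Coincidence is visible in the sign patterns: the edge `a b` carries a stress alone exactly when
its ends coincide. -/
theorem FiberEquiv.apply_eq {P Q : Configuration (Fin 4) 2}
    (h : FiberEquiv (⊤ : SimpleGraph (Fin 4)) P Q) {a b : Fin 4} (hP : P a = P b) :
    Q a = Q b := by
  by_cases hab : a = b
  · rw [hab]
  obtain ⟨w, hw, hs⟩ := h.exists_sign_eq (edgeStress_mem hab hP)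
  refine eq_of_support_edge hw (a := a) (b := b) ?_ fun j hj => ?_
  · rw [← sign_ne_zero, hs]; simp [edgeStress]
  · rw [← sign_eq_zero_iff, hs, sign_eq_zero_iff, edgeStress, if_neg]
    rintro (⟨-, h⟩ | ⟨h, -⟩)
    · exact hj h
    · exact hab h

/-- The stress supported on three points of a line. -/
def tripleStress (x : Fin 4 → ℝ) (a b c i j : Fin 4) : ℝ :=
  (x c - x a) * (x c - x b) * edgeStress a b i j + (x a - x b) * (x a - x c) * edgeStress b c i j +
    (x b - x a) * (x b - x c) * edgeStress a c i j

/-- The weights are the negatives of the pairwise products of the entries of the affine dependency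
`(x b - x c, x c - x a, x a - x b)` of the three points on the line. -/
theorem tripleStress_mem {p v : EuclideanSpace ℝ (Fin 2)} (hv : v ≠ 0) {x : Fin 4 → ℝ}
    {a b c : Fin 4} (hab : a ≠ b) (hbc : b ≠ c) (hac : a ≠ c) :
    tripleStress x a b c ∈ selfStress (⊤ : SimpleGraph (Fin 4)) (lineConfig p v x) := by
  refine (mem_selfStress_lineConfig hv).2 ⟨fun i j => ?_, fun i => ?_, fun i => ?_⟩
  · simp only [tripleStress, edgeStress_comm _ _ i j]
  · simp [tripleStress, edgeStress_self, *]
  · have : ∀ e f : Fin 4, e ≠ f → ∀ c : ℝ, ∑ j, c * edgeStress e f i j * (x j - x i) =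
        if i = e then c * (x f - x e) else if i = f then c * (x e - x f) else 0 := by
      intro e f hef c
      by_cases h1 : i = e
      · subst h1
        rw [Finset.sum_eq_single f] <;> simp +contextual [edgeStress, hef]
      by_cases h2 : i = f
      · subst h2
        rw [Finset.sum_eq_single e] <;> simp +contextual [edgeStress, h1]
      · simp [edgeStress, h1, h2]
    simp only [tripleStress, add_mul, Finset.sum_add_distrib]
    rw [this a b hab, this b c hbc, this a c hac]
    by_cases h1 : i = a
    · subst h1; simp [hab, hac]; ring
    by_cases h2 : i = b
    · subst h2; simp [h1, hbc]; ring
    by_cases h3 : i = c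
    · subst h3; simp [h1, h2]; ring
    · simp [h1, h2, h3]

/-! ### The dimension of the fiber over a collinear configuration -/

/-- Symmetric families that vanish on the diagonal, given by their six values. -/
def symmEquiv : selfStress (⊤ : SimpleGraph (Fin 4)) (0 : Configuration (Fin 4) 2) ≃ₗ[ℝ]
    (Fin 6 → ℝ) where
  toFun w := ![w.1 0 1, w.1 0 2, w.1 0 3, w.1 1 2, w.1 1 3, w.1 2 3]
  map_add' u w := by ext i; fin_cases i <;> rfl
  map_smul' c w := by ext i; fin_cases i <;> rfl
  invFun u := ⟨![![0, u 0, u 1, u 2], ![u 0, 0, u 3, u 4], ![u 1, u 3, 0, u 5],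
    ![u 2, u 4, u 5, 0]], by
      refine mem_selfStress_top.2 ⟨fun i j => ?_, fun i => ?_, fun i => by simp⟩
      · fin_cases i <;> fin_cases j <;> rfl
      · fin_cases i <;> rfl⟩
  left_inv w := by
    obtain ⟨w, hw⟩ := w
    obtain ⟨h1, h2, -⟩ := mem_selfStress_top.1 hw
    ext i j
    fin_cases i <;> fin_cases j <;> simp [h1, h2] <;> exact h1 _ _
  right_inv u := by ext i; fin_cases i <;> rfl

/-- Over the zero configuration equilibrium is vacuous, so this fiber serves as the ambient space of
all weights on the six edges. -/
theorem finrank_selfStress_zero :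
    Module.finrank ℝ (selfStress (⊤ : SimpleGraph (Fin 4)) (0 : Configuration (Fin 4) 2)) = 6 := by
  rw [symmEquiv.finrank_eq]; simp

theorem selfStress_const (P : Configuration (Fin 4) 2) (h : ∀ i j, P i = P j) :
    selfStress (⊤ : SimpleGraph (Fin 4)) P =
      selfStress (⊤ : SimpleGraph (Fin 4)) (0 : Configuration (Fin 4) 2) := by
  ext w
  rw [mem_selfStress_top, mem_selfStress_top]
  simp [fun i j => sub_eq_zero.2 (h i j)]

/-- The resultant forces of a family of edge weights on points of a line. -/
def lineForce (x : Fin 4 → ℝ) :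
    selfStress (⊤ : SimpleGraph (Fin 4)) (0 : Configuration (Fin 4) 2) →ₗ[ℝ] (Fin 4 → ℝ) where
  toFun w i := ∑ j, w.1 i j * (x j - x i)
  map_add' u w := by ext i; simp [add_mul, Finset.sum_add_distrib]
  map_smul' c w := by ext i; simp [mul_assoc, Finset.mul_sum]

theorem lineForce_edgeStress (x : Fin 4 → ℝ) {a b : Fin 4} (hab : a ≠ b) :
    lineForce x ⟨edgeStress a b, edgeStress_mem hab rfl⟩ =
      (x b - x a) • (Pi.single a 1 - Pi.single b 1) := by
  ext i
  simp only [lineForce, LinearMap.coe_mk, AddHom.coe_mk]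
  by_cases h1 : i = a
  · subst h1
    rw [Finset.sum_eq_single b] <;> simp +contextual [edgeStress, hab]
  by_cases h2 : i = b
  · subst h2
    rw [Finset.sum_eq_single a] <;> simp +contextual [edgeStress, h1]
  · simp [edgeStress, h1, h2]

/-- An edge of nonzero length produces a pair of opposite forces at its ends; two coinciding points
are joined by a detour through a point at another position. -/
theorem single_sub_single_mem_range {x : Fin 4 → ℝ} (hx : ∃ i j, x i ≠ x j) (a b : Fin 4) :
    (Pi.single a 1 - Pi.single b 1 : Fin 4 → ℝ) ∈ LinearMap.range (lineForce x) := by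
  have key : ∀ a b, x a ≠ x b →
      (Pi.single a 1 - Pi.single b 1 : Fin 4 → ℝ) ∈ LinearMap.range (lineForce x) := by
    intro a b h
    have hab : a ≠ b := fun e => h (by rw [e])
    have h0 : x b - x a ≠ 0 := sub_ne_zero.2 h.symm
    have := Submodule.smul_mem _ (x b - x a)⁻¹
      (LinearMap.mem_range_self (lineForce x) ⟨edgeStress a b, edgeStress_mem hab rfl⟩)
    rwa [lineForce_edgeStress x hab, smul_smul, inv_mul_cancel₀ h0, one_smul] at this
  by_cases h : x a = x b
  · obtain ⟨c, hc⟩ : ∃ c, x a ≠ x c := by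
      by_contra! hc
      obtain ⟨i, j, hij⟩ := hx
      exact hij ((hc i).symm.trans (hc j))
    have := Submodule.add_mem _ (key a c hc) (key c b (h ▸ hc.symm))
    rwa [sub_add_sub_cancel] at this
  · exact key a b h

/-- The range is the hyperplane of vectors of sum zero: symmetric weights produce forces that cancel
in total, and the differences of unit vectors span the hyperplane. -/
theorem finrank_range_lineForce {x : Fin 4 → ℝ} (hx : ∃ i j, x i ≠ x j) :
    Module.finrank ℝ (LinearMap.range (lineForce x)) = 3 := by
  let σ : (Fin 4 → ℝ) →ₗ[ℝ] ℝ := ∑ i, LinearMap.proj i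
  have hσ : ∀ y, σ y = ∑ i, y i := fun y => by simp [σ]
  have hr : LinearMap.range (lineForce x) = LinearMap.ker σ := by
    ext y
    rw [LinearMap.mem_ker, hσ]
    constructor
    · rintro ⟨⟨w, hw⟩, rfl⟩
      obtain ⟨h1, -, -⟩ := mem_selfStress_top.1 hw
      have : ∑ i, ∑ j, w i j * (x j - x i) = -∑ i, ∑ j, w i j * (x j - x i) := by
        conv_lhs => rw [Finset.sum_comm]
        simp only [← Finset.sum_neg_distrib]
        refine Finset.sum_congr rfl fun i _ => Finset.sum_congr rfl fun j _ => ?_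
        rw [h1 j i]; ring
      change ∑ i, ∑ j, w i j * (x j - x i) = 0
      linarith
    · intro hy
      have : y = ∑ i, y i • (Pi.single i 1 - Pi.single 0 1 : Fin 4 → ℝ) := by
        simp only [smul_sub, Finset.sum_sub_distrib, ← Finset.sum_smul, hy, zero_smul, sub_zero]
        ext j
        simp [Pi.single_apply]
      rw [this]
      exact Submodule.sum_mem _ fun i _ =>
        Submodule.smul_mem _ _ (single_sub_single_mem_range hx i 0)
  have hsurj : LinearMap.range σ = ⊤ := by
    rw [LinearMap.range_eq_top]
    intro c
    exact ⟨Pi.single 0 c, by rw [hσ]; simp⟩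
  have := LinearMap.finrank_range_add_finrank_ker σ
  rw [hsurj] at this
  simp at this
  rw [hr]
  omega

/-- The fiber is the kernel of `lineForce x`, so rank-nullity gives 6 - 3. -/
theorem finrank_selfStress_lineConfig {p v : EuclideanSpace ℝ (Fin 2)} (hv : v ≠ 0)
    {x : Fin 4 → ℝ} (hx : ∃ i j, x i ≠ x j) :
    Module.finrank ℝ (selfStress (⊤ : SimpleGraph (Fin 4)) (lineConfig p v x)) = 3 := by
  have h1 := LinearMap.finrank_range_add_finrank_ker (lineForce x)
  rw [finrank_range_lineForce hx, finrank_selfStress_zero] at h1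
  have h2 : (LinearMap.ker (lineForce x)).map (Submodule.subtype _) =
      selfStress (⊤ : SimpleGraph (Fin 4)) (lineConfig p v x) := by
    ext w
    rw [mem_selfStress_lineConfig hv, Submodule.mem_map]
    constructor
    · rintro ⟨⟨w, hw⟩, hk, rfl⟩
      obtain ⟨h1, h2, -⟩ := mem_selfStress_top.1 hw
      exact ⟨h1, h2, fun i => congrFun (LinearMap.mem_ker.1 hk) i⟩
    · rintro ⟨h1, h2, h3⟩
      refine ⟨⟨w, mem_selfStress_top.2 ⟨h1, h2, by simp⟩⟩, ?_, rfl⟩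
      exact LinearMap.mem_ker.2 (funext h3)
  rw [← h2, (Submodule.equivMapOfInjective _ (Submodule.injective_subtype _) _).symm.finrank_eq]
  omega

theorem two_le_finrank_of_collinear {P : Configuration (Fin 4) 2} (hP : affDep P = 0) :
    2 ≤ Module.finrank ℝ (selfStress (⊤ : SimpleGraph (Fin 4)) P) := by
  obtain ⟨p, v, x, hv, rfl⟩ := exists_eq_lineConfig hP
  by_cases hx : ∃ i j, x i ≠ x j
  · rw [finrank_selfStress_lineConfig hv hx]; norm_num
  · push Not at hx
    rw [selfStress_const _ fun i j => (lineConfig_apply_eq_iff hv x i j).2 (hx i j),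
      finrank_selfStress_zero]
    norm_num

/-- Collinear and non-collinear configurations do not have equivalent fibers. -/
theorem FiberEquiv.affDep_ne_zero {P Q : Configuration (Fin 4) 2}
    (h : FiberEquiv (⊤ : SimpleGraph (Fin 4)) P Q) (hP : affDep P ≠ 0) : affDep Q ≠ 0 := by
  intro hQ
  obtain ⟨i, j, hij, hne⟩ := exists_mul_ne_zero (sum_affDep P) hP
  let f : selfStress (⊤ : SimpleGraph (Fin 4)) Q →ₗ[ℝ] ℝ :=
    (LinearMap.proj j ∘ₗ (LinearMap.proj i : (Fin 4 → Fin 4 → ℝ) →ₗ[ℝ] (Fin 4 → ℝ))) ∘ₗ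
      Submodule.subtype _
  -- The homeomorphism need not be linear, so dimensions are compared through signs: a fiber of
  -- dimension at least 2 contains a nonzero stress vanishing on the edge `i j`, whereas over `P`
  -- vanishing on this edge forces the whole stress to be zero.
  have hf : LinearMap.ker f ≠ ⊥ := LinearMap.ker_ne_bot_of_finrank_lt (by
    have := two_le_finrank_of_collinear hQ
    simp only [Module.finrank_self]
    omega)
  obtain ⟨⟨w, hw⟩, hwf, hw0⟩ := (Submodule.ne_bot_iff _).1 hf
  have hwij : w i j = 0 := hwf
  obtain ⟨w', hw', hs⟩ := h.symm.exists_sign_eq hw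
  obtain ⟨c, rfl⟩ := exists_eq_smul_depStress hP hw'
  have h1 := hs i j
  rw [hwij, sign_zero, sign_eq_zero_iff] at h1
  have hc : c = 0 := by simpa [depStress, hij, hne] using h1
  apply hw0
  ext k l
  have h2 := hs k l
  simpa [hc] using h2.symm

/-! ### The order of collinear points as an invariant of the fiber -/

/-- The sign of `(x a - x b) * (x c - x b)` tells whether `x b` is between `x a` and `x c`. -/
def betweenSign {R : Type*} [CommRing R] [LinearOrder R] (x : Fin 4 → R) (a b c : Fin 4) :
    SignType :=
  SignType.sign (x a - x b) * SignType.sign (x c - x b)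

/-- When `b` lies between `a` and `c`, `tripleStress` is positive on both edges from `b` to `a` and
`c` and zero on the remaining edge at `b`. A stress with these signs over the other configuration
balances at `b` only if `y a` and `y c` are on opposite sides of `y b`. -/
theorem FiberEquiv.coord_sub_mul_neg {p v q u : EuclideanSpace ℝ (Fin 2)} {x y : Fin 4 → ℝ}
    (hv : v ≠ 0) (hu : u ≠ 0)
    (h : FiberEquiv (⊤ : SimpleGraph (Fin 4)) (lineConfig p v x) (lineConfig q u y))
    {a b c : Fin 4} (hx : (x a - x b) * (x c - x b) < 0) : (y a - y b) * (y c - y b) < 0 := by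
  have hinj : ∀ i j, y i = y j → x i = x j := fun i j hy =>
    (lineConfig_apply_eq_iff hv x i j).1
      (h.symm.apply_eq ((lineConfig_apply_eq_iff hu y i j).2 hy))
  have hxab : x a ≠ x b := by rintro e; simp [e] at hx
  have hxbc : x c ≠ x b := by rintro e; simp [e] at hx
  have hxac : x a ≠ x c := by
    intro e; rw [e] at hx; nlinarith [mul_self_nonneg (x c - x b)]
  have hab : a ≠ b := fun e => hxab (by rw [e])
  have hbc : b ≠ c := fun e => hxbc (by rw [e])
  have hac : a ≠ c := fun e => hxac (by rw [e])
  obtain ⟨w, hw, hs⟩ := h.exists_sign_eq (tripleStress_mem (p := p) hv (x := x) hab hbc hac)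
  obtain ⟨h1, h2, h3⟩ := (mem_selfStress_lineConfig hu).1 hw
  have hab' : 0 < w b a := by
    rw [← sign_eq_one_iff, hs, sign_eq_one_iff]
    have : (x c - x a) * (x c - x b) > 0 := by
      have : 0 < (x c - x b) * (x c - x b) := mul_self_pos.2 (sub_ne_zero.2 hxbc)
      nlinarith
    simpa [tripleStress, edgeStress, hab, hbc, hac, hab.symm, hbc.symm, hac.symm] using this
  have hbc' : 0 < w b c := by
    rw [← sign_eq_one_iff, hs, sign_eq_one_iff]
    have : (x a - x b) * (x a - x c) > 0 := by
      have : 0 < (x a - x b) * (x a - x b) := mul_self_pos.2 (sub_ne_zero.2 hxab)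
      nlinarith
    simpa [tripleStress, edgeStress, hab, hbc, hac, hab.symm, hbc.symm, hac.symm] using this
  have hrest : ∀ j, j ≠ a → j ≠ c → w b j = 0 := by
    intro j hja hjc
    rw [← sign_eq_zero_iff, hs, sign_eq_zero_iff]
    simp [tripleStress, edgeStress, hja, hjc, hab.symm, hbc]
  have h4 := h3 b
  rw [← Finset.sum_subset (Finset.subset_univ {a, c}), Finset.sum_pair hac] at h4
  · have hya : y a - y b ≠ 0 := fun e => hxab (hinj a b (sub_eq_zero.1 e))
    have h5 : w b c * ((y a - y b) * (y c - y b)) = -(w b a * ((y a - y b) * (y a - y b))) := by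
      linear_combination (y a - y b) * h4
    have h6 : 0 < w b a * ((y a - y b) * (y a - y b)) := mul_pos hab' (mul_self_pos.2 hya)
    by_contra! h7
    have := mul_nonneg hbc'.le h7
    linarith
  · intro j _ hj
    simp only [Finset.mem_insert, Finset.mem_singleton, not_or] at hj
    rw [hrest j hj.1 hj.2, zero_mul]

/-- Equivalent fibers over collinear configurations determine the order of the points up to
reversal. -/
theorem FiberEquiv.betweenSign_eq {p v q u : EuclideanSpace ℝ (Fin 2)} {x y : Fin 4 → ℝ}
    (hv : v ≠ 0) (hu : u ≠ 0)
    (h : FiberEquiv (⊤ : SimpleGraph (Fin 4)) (lineConfig p v x) (lineConfig q u y)) :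
    betweenSign x = betweenSign y := by
  ext a b c
  have hinj : ∀ i j, y i = y j ↔ x i = x j := fun i j => by
    rw [← lineConfig_apply_eq_iff hu y i j (p := q), ← lineConfig_apply_eq_iff hv x i j (p := p)]
    exact ⟨h.symm.apply_eq, h.apply_eq⟩
  simp only [betweenSign, ← sign_mul]
  rcases lt_trichotomy ((x a - x b) * (x c - x b)) 0 with hx | hx | hx
  · rw [sign_neg hx, sign_neg (h.coord_sub_mul_neg hv hu hx)]
  · have hy : (y a - y b) * (y c - y b) = 0 := by
      rw [mul_eq_zero, sub_eq_zero, sub_eq_zero] at hx ⊢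
      rwa [hinj, hinj]
    rw [hx, hy]
  · rcases lt_trichotomy ((y a - y b) * (y c - y b)) 0 with hy | hy | hy
    · exact absurd (h.symm.coord_sub_mul_neg hu hv hy) hx.not_gt
    · rw [mul_eq_zero, sub_eq_zero, sub_eq_zero, hinj, hinj, ← sub_eq_zero, ← @sub_eq_zero _ _ (x c),
        ← mul_eq_zero] at hy
      exact absurd hy hx.ne'
    · rw [sign_pos hx, sign_pos hy]

/-- Scaling each weight by the ratio of the two lengths of its edge keeps the force along that edge
unchanged, hence keeps equilibrium. The ratios are positive because the orders agree; an edge of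
length zero exerts no force and may have any factor. -/
theorem fiberEquiv_lineConfig {p v q u : EuclideanSpace ℝ (Fin 2)} {x y : Fin 4 → ℝ}
    (hv : v ≠ 0) (hu : u ≠ 0)
    (h : ∀ i j, SignType.sign (x i - x j) = SignType.sign (y i - y j)) :
    FiberEquiv (⊤ : SimpleGraph (Fin 4)) (lineConfig p v x) (lineConfig q u y) := by
  have hz : ∀ i j, x i - x j = 0 ↔ y i - y j = 0 := fun i j => by
    rw [← sign_eq_zero_iff, h, sign_eq_zero_iff]
  let ρ : Fin 4 → Fin 4 → ℝ := fun i j =>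
    if x i - x j = 0 then 1 else (x i - x j) / (y i - y j)
  have hρ : ∀ i j, 0 < ρ i j := by
    intro i j
    by_cases hi : x i - x j = 0
    · simp [ρ, hi]
    · simp only [ρ, hi, if_false]
      rcases lt_or_gt_of_ne hi with h' | h'
      · have := h i j
        rw [sign_neg h', eq_comm, sign_eq_neg_one_iff] at this
        exact div_pos_of_neg_of_neg h' this
      · have := h i j
        rw [sign_pos h', eq_comm, sign_eq_one_iff] at this
        exact div_pos h' this
  have hmul : ∀ i j, ρ i j * (y j - y i) = x j - x i := by
    intro i j
    by_cases hi : x i - x j = 0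
    · have hy := (hz i j).1 hi
      simp only [ρ, hi, if_true]
      linarith
    · have hy := mt (hz i j).2 hi
      simp only [ρ, hi, if_false]
      field_simp
      ring
  have hsymm : ∀ i j, ρ i j = ρ j i := by
    intro i j
    by_cases hi : x i - x j = 0
    · have hi' : x j - x i = 0 := by linarith
      simp [ρ, hi, hi']
    · have hi' : x j - x i ≠ 0 := fun e => hi (by linarith)
      simp only [ρ, hi, hi', if_false]
      rw [← neg_sub, ← neg_sub (y j), neg_div_neg_eq]
  refine FiberEquiv.of_scaling ρ hρ ?_ ?_
  · intro w hw
    obtain ⟨h1, h2, h3⟩ := (mem_selfStress_lineConfig hv).1 hw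
    refine (mem_selfStress_lineConfig hu).2 ⟨fun i j => ?_, fun i => ?_, fun i => ?_⟩
    · rw [hsymm, h1]
    · rw [h2, mul_zero]
    · rw [← h3 i]
      refine Finset.sum_congr rfl fun j _ => ?_
      rw [← hmul]; ring
  · intro w hw
    obtain ⟨h1, h2, h3⟩ := (mem_selfStress_lineConfig hu).1 hw
    refine (mem_selfStress_lineConfig hv).2 ⟨fun i j => ?_, fun i => ?_, fun i => ?_⟩
    · rw [hsymm, h1]
    · rw [h2, mul_zero]
    · rw [← h3 i]
      refine Finset.sum_congr rfl fun j _ => ?_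
      have := (hρ i j).ne'
      rw [← hmul]
      field_simp

/-! ### Labels of the strata -/

/-- A label: the sign vector of the affine dependency (points not on a line), or the ranks of
the points along a line. -/
abbrev Label : Type := (Fin 4 → SignType) ⊕ (Fin 4 → Fin 4)

/-- The sign of `r i - r j`. -/
def rankSign (r : Fin 4 → Fin 4) (i j : Fin 4) : SignType :=
  if r j < r i then 1 else if r i < r j then -1 else 0

/-- Sign vectors must take both signs. Ranks must form an initial segment, and among the two
directions of the line the one is chosen for which the first point that differs from the point
`0` comes after it. -/
def Label.IsValid : Label → Prop
  | .inl s => (∃ i, s i = 1) ∧ ∃ i, s i = -1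
  | .inr r => (∀ i, ∀ k < r i, ∃ j, r j = k) ∧ ∀ i, r i < r 0 → ∃ j < i, r 0 < r j

instance : DecidablePred Label.IsValid := fun l => by
  cases l <;> unfold Label.IsValid <;> infer_instance

/-- The configurations with a given label. -/
def Label.stratum : Label → Set (Configuration (Fin 4) 2)
  | .inl s => {P | ∀ i, SignType.sign (affDep P i) = s i}
  | .inr r => {P | ∃ p v x, v ≠ 0 ∧ (∀ i j, SignType.sign (x i - x j) = rankSign r i j) ∧
      P = lineConfig p v x}

theorem rankSign_eq_of_lt_iff {x : Fin 4 → ℝ} {r : Fin 4 → Fin 4}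
    (h : ∀ i j, r i < r j ↔ x i < x j) (i j : Fin 4) :
    SignType.sign (x i - x j) = rankSign r i j := by
  unfold rankSign
  split_ifs with h1 h2
  · rw [sign_eq_one_iff, sub_pos, ← h]; exact h1
  · rw [sign_eq_neg_one_iff, sub_neg, ← h]; exact h2
  · rw [sign_eq_zero_iff, sub_eq_zero]
    exact le_antisymm (not_lt.1 (mt (h j i).2 h1)) (not_lt.1 (mt (h i j).2 h2))

theorem lt_iff_of_rankSign_eq {x : Fin 4 → ℝ} {r : Fin 4 → Fin 4}
    (h : ∀ i j, SignType.sign (x i - x j) = rankSign r i j) (i j : Fin 4) :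
    r i < r j ↔ x i < x j := by
  rw [← sub_neg (a := x i), ← sign_eq_neg_one_iff, h]
  unfold rankSign
  split_ifs with h1 h2
  · simpa using h1.le
  · simpa using h2
  · simpa using not_lt.1 h2

theorem eq_iff_of_rankSign_eq {x : Fin 4 → ℝ} {r : Fin 4 → Fin 4}
    (h : ∀ i j, SignType.sign (x i - x j) = rankSign r i j) (i j : Fin 4) :
    r i = r j ↔ x i = x j := by
  have h1 := lt_iff_of_rankSign_eq h i j
  have h2 := lt_iff_of_rankSign_eq h j i
  rw [le_antisymm_iff, le_antisymm_iff, ← not_lt, ← not_lt, h1, h2, not_lt, not_lt]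

theorem affDep_ne_zero_of_mem {s : Fin 4 → SignType} (hs : Label.IsValid (.inl s))
    {P : Configuration (Fin 4) 2} (hP : P ∈ Label.stratum (.inl s)) : affDep P ≠ 0 := by
  obtain ⟨⟨i, hi⟩, -⟩ := hs
  intro h
  have := hP i
  rw [h, hi] at this
  simp at this

theorem affDep_eq_zero_of_mem {r : Fin 4 → Fin 4} {P : Configuration (Fin 4) 2}
    (hP : P ∈ Label.stratum (.inr r)) : affDep P = 0 := by
  obtain ⟨p, v, x, -, -, rfl⟩ := hP
  exact affDep_lineConfig p v x

/-- The rank of a point is the position of its coordinate in the sorted list of distinct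
coordinates. -/
theorem exists_initial_ranks (x : Fin 4 → ℝ) :
    ∃ r : Fin 4 → Fin 4, (∀ i j, r i < r j ↔ x i < x j) ∧ ∀ i, ∀ k < r i, ∃ j, r j = k := by
  let F := Finset.univ.image x
  have hF : F.card ≤ 4 := Finset.card_image_le
  let e := F.orderIsoOfFin rfl
  have hm : ∀ i, x i ∈ F := fun i => Finset.mem_image_of_mem x (Finset.mem_univ i)
  refine ⟨fun i => Fin.castLE hF (e.symm ⟨x i, hm i⟩), fun i j => ?_, fun i k hk => ?_⟩
  · rw [(Fin.strictMono_castLE hF).lt_iff_lt, e.symm.lt_iff_lt]; rfl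
  · have hk' : (k : ℕ) < F.card := lt_of_lt_of_le (Fin.lt_def.1 hk) (e.symm ⟨x i, hm i⟩).2.le
    obtain ⟨j, -, hj⟩ := Finset.mem_image.1 (e ⟨k, hk'⟩).2
    refine ⟨j, ?_⟩
    have : (⟨x j, hm j⟩ : F) = e ⟨k, hk'⟩ := Subtype.ext hj
    simp [this]

/-- Let `i` be the first index with `x i ≠ x 0`, and orient the line so that it comes after `0`. Any
point before `0` then has an index larger than `i`. -/
theorem canonical_orientation (x : Fin 4 → ℝ) :
    (∀ i, x i < x 0 → ∃ j < i, x 0 < x j) ∨ ∀ i, -x i < -x 0 → ∃ j < i, -x 0 < -x j := by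
  by_cases h : ∃ i, x i ≠ x 0
  · obtain ⟨i, hi, hmin⟩ := wellFounded_lt.has_min {i | x i ≠ x 0} h
    have hlt : ∀ j, x j ≠ x 0 → j ≠ i → i < j := fun j hj hji =>
      lt_of_le_of_ne (not_lt.1 (hmin j hj)) hji.symm
    rcases lt_or_gt_of_ne hi with h' | h'
    · refine Or.inr fun j hj => ⟨i, hlt j (by intro e; simp [e] at hj) ?_, by linarith⟩
      rintro rfl; linarith
    · refine Or.inl fun j hj => ⟨i, hlt j hj.ne ?_, h'⟩
      rintro rfl; linarith
  · push Not at h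
    exact Or.inl fun i hi => absurd (h i) hi.ne

theorem lineConfig_neg (p v : EuclideanSpace ℝ (Fin 2)) (x : Fin 4 → ℝ) :
    lineConfig p (-v) (-x) = lineConfig p v x := by
  ext i; simp [lineConfig]

theorem exists_label (P : Configuration (Fin 4) 2) : ∃ l : Label, l.IsValid ∧ P ∈ l.stratum := by
  by_cases h : affDep P = 0
  · obtain ⟨p, v, x, hv, rfl⟩ := exists_eq_lineConfig h
    have key : ∀ (v : EuclideanSpace ℝ (Fin 2)) (x : Fin 4 → ℝ), v ≠ 0 →
        (∀ i, x i < x 0 → ∃ j < i, x 0 < x j) →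
        ∃ l : Label, l.IsValid ∧ lineConfig p v x ∈ l.stratum := by
      intro v x hv hx
      obtain ⟨r, hr, hi⟩ := exists_initial_ranks x
      refine ⟨.inr r, ⟨hi, fun i h => ?_⟩, p, v, x, hv, rankSign_eq_of_lt_iff hr, rfl⟩
      simpa only [hr] using hx i ((hr _ _).1 h)
    rcases canonical_orientation x with hx | hx
    · exact key v x hv hx
    · rw [← lineConfig_neg]
      exact key (-v) (-x) (neg_ne_zero.2 hv) hx
  · have hne : ∃ i ∈ Finset.univ, affDep P i ≠ 0 := by
      obtain ⟨i, hi⟩ := Function.ne_iff.1 h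
      exact ⟨i, Finset.mem_univ i, hi⟩
    refine ⟨.inl fun i => SignType.sign (affDep P i), ⟨?_, ?_⟩, fun i => rfl⟩
    · obtain ⟨i, -, hi⟩ := Finset.exists_pos_of_sum_zero_of_exists_nonzero _ (sum_affDep P) hne
      exact ⟨i, sign_pos hi⟩
    · obtain ⟨i, -, hi⟩ := Finset.exists_pos_of_sum_zero_of_exists_nonzero
        (s := Finset.univ) (fun i => -affDep P i) (by simp [sum_affDep]) (by simpa using hne)
      exact ⟨i, sign_neg (by linarith)⟩

/-- Betweenness and coincidences determine a weak order up to reversal, and validity selects one of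
the two directions. -/
theorem rank_eq_of_betweenSign_eq : ∀ r : Fin 4 → Fin 4, Label.IsValid (.inr r) →
    ∀ r' : Fin 4 → Fin 4, Label.IsValid (.inr r') →
    (∀ a b c, rankSign r a b * rankSign r c b = rankSign r' a b * rankSign r' c b) → r = r' := by
  decide +kernel

/-- Collinear configurations with equivalent fibers have the same label. -/
theorem rank_eq_of_fiberEquiv {r r' : Fin 4 → Fin 4} (hr : Label.IsValid (.inr r))
    (hr' : Label.IsValid (.inr r')) {P Q : Configuration (Fin 4) 2}
    (hP : P ∈ Label.stratum (.inr r)) (hQ : Q ∈ Label.stratum (.inr r'))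
    (h : FiberEquiv (⊤ : SimpleGraph (Fin 4)) P Q) : r = r' := by
  obtain ⟨p, v, x, hv, hx, rfl⟩ := hP
  obtain ⟨q, u, y, hu, hy, rfl⟩ := hQ
  refine rank_eq_of_betweenSign_eq r hr r' hr' fun a b c => ?_
  have := congrFun (congrFun (congrFun (h.betweenSign_eq hv hu) a) b) c
  simpa only [betweenSign, hx, hy] using this

/-- In the collinear case the two labels may come from different parametrizations of the line; they
agree because the fiber over `P` is equivalent to itself. -/
theorem label_unique {l l' : Label} (hl : l.IsValid) (hl' : l'.IsValid)
    {P : Configuration (Fin 4) 2} (hP : P ∈ l.stratum) (hP' : P ∈ l'.stratum) : l = l' := by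
  rcases l with s | r <;> rcases l' with s' | r'
  · congr 1
    ext i
    rw [← hP i, ← hP' i]
  · exact absurd (affDep_eq_zero_of_mem hP') (affDep_ne_zero_of_mem hl hP)
  · exact absurd (affDep_eq_zero_of_mem hP) (affDep_ne_zero_of_mem hl' hP')
  · rw [rank_eq_of_fiberEquiv hl hl' hP hP' (FiberEquiv.refl _ P)]

theorem fiberEquiv_of_mem_stratum {l : Label} (hl : l.IsValid) {P Q : Configuration (Fin 4) 2}
    (hP : P ∈ l.stratum) (hQ : Q ∈ l.stratum) : FiberEquiv (⊤ : SimpleGraph (Fin 4)) P Q := by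
  rcases l with s | r
  · exact fiberEquiv_of_sign_affDep (affDep_ne_zero_of_mem hl hP) (affDep_ne_zero_of_mem hl hQ)
      fun i => (hP i).trans (hQ i).symm
  · obtain ⟨p, v, x, hv, hx, rfl⟩ := hP
    obtain ⟨q, u, y, hu, hy, rfl⟩ := hQ
    exact fiberEquiv_lineConfig hv hu fun i j => (hx i j).trans (hy i j).symm

/-- As the entries sum to zero, a nonzero entry has a nonzero partner `j`. The generator of the
fiber over `P` is then nonzero on the edge `i j`, which is impossible over `Q` if its entry `i`
vanishes. -/
theorem FiberEquiv.affDep_apply_ne_zero {P Q : Configuration (Fin 4) 2}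
    (h : FiberEquiv (⊤ : SimpleGraph (Fin 4)) P Q) {i : Fin 4} (hP : affDep P i ≠ 0) :
    affDep Q i ≠ 0 := by
  have hP0 : affDep P ≠ 0 := fun e => hP (by simp [e])
  obtain ⟨ε, hε⟩ := h.exists_sign_mul_eq (h.affDep_ne_zero hP0)
  obtain ⟨j, hji, hj⟩ : ∃ j, j ≠ i ∧ affDep P j ≠ 0 := by
    by_contra! hc
    refine hP ?_
    rw [← sum_affDep P]
    exact (Finset.sum_eq_single i (fun j _ hj => hc j hj) (by simp)).symm
  intro hQ
  have := hε i j hji.symm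
  rw [hQ, sign_zero, zero_mul, mul_zero, ← sign_mul, sign_eq_zero_iff, mul_eq_zero] at this
  exact this.elim hP hj

theorem sign_eq_of_isPreconnected {X : Type*} [TopologicalSpace X] {A : Set X}
    (hA : IsPreconnected A) {f : X → ℝ} (hf : Continuous f) (h0 : ∀ x ∈ A, f x ≠ 0) {x y : X}
    (hx : x ∈ A) (hy : y ∈ A) : SignType.sign (f x) = SignType.sign (f y) := by
  refine hA.constant (f := fun x => SignType.sign (f x)) ?_ hx hy
  intro z hz
  exact ((continuousAt_sign_of_ne_zero (h0 z hz)).comp hf.continuousAt).continuousWithinAt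

/-- A connected set of configurations with equivalent fibers that meets a stratum is contained in
it. -/
theorem subset_stratum {l : Label} (hl : l.IsValid) {A : Set (Configuration (Fin 4) 2)}
    (hA : IsPreconnected A)
    (hE : ∀ P ∈ A, ∀ Q ∈ A, FiberEquiv (⊤ : SimpleGraph (Fin 4)) P Q)
    {P : Configuration (Fin 4) 2} (hPA : P ∈ A) (hP : P ∈ l.stratum) : A ⊆ l.stratum := by
  intro Q hQ
  rcases l with s | r
  · intro i
    rw [← hP i]
    by_cases h0 : affDep P i = 0
    · have : affDep Q i = 0 := by
        by_contra hc
        exact (hE Q hQ P hPA).affDep_apply_ne_zero hc h0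
      rw [h0, this]
    -- Connectedness is needed here: equivalence of fibers alone does not separate a sign vector
    -- from its negative.
    · exact sign_eq_of_isPreconnected hA ((continuous_apply i).comp continuous_affDep)
        (fun R hR => (hE P hPA R hR).affDep_apply_ne_zero h0) hQ hPA
  · obtain ⟨l', hl', hQl⟩ := exists_label Q
    rcases l' with s' | r'
    · exact absurd (affDep_eq_zero_of_mem hP)
        ((hE Q hQ P hPA).affDep_ne_zero (affDep_ne_zero_of_mem hl' hQl))
    -- For collinear points the fiber alone determines the label.
    · rwa [rank_eq_of_fiberEquiv hl hl' hP hQl (hE P hPA Q hQ)]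

/-! ### Geometric conditions in coordinates -/
theorem sbtw_real_iff {x y z : ℝ} : Sbtw ℝ x y z ↔ (x - y) * (z - y) < 0 := by
  rw [sbtw_iff_mem_image_Ioo_and_ne]
  constructor
  · rintro ⟨⟨t, ⟨h0, h1⟩, rfl⟩, hne⟩
    have h2 : 0 < (z - x) * (z - x) := mul_self_pos.2 (sub_ne_zero.2 hne.symm)
    have h3 : 0 < t * (1 - t) := mul_pos h0 (by linarith)
    have h4 := mul_pos h3 h2
    rw [AffineMap.lineMap_apply_ring']
    nlinarith
  · intro h
    have hne : x ≠ z := by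
      rintro rfl
      exact absurd h (mul_self_nonneg _).not_gt
    have hz : z - x ≠ 0 := sub_ne_zero.2 hne.symm
    refine ⟨⟨(y - x) / (z - x), ?_, ?_⟩, hne⟩
    · rcases mul_neg_iff.1 h with ⟨h1, h2⟩ | ⟨h1, h2⟩
      · exact ⟨div_pos_of_neg_of_neg (by linarith) (by linarith),
          (div_lt_one_of_neg (by linarith)).2 (by linarith)⟩
      · exact ⟨div_pos (by linarith) (by linarith), (div_lt_one (by linarith)).2 (by linarith)⟩
    · rw [AffineMap.lineMap_apply_ring']
      field_simp
      ring

theorem sbtw_lineConfig_iff {p v : EuclideanSpace ℝ (Fin 2)} (hv : v ≠ 0) (x : Fin 4 → ℝ)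
    (a b c : Fin 4) :
    Sbtw ℝ (lineConfig p v x a) (lineConfig p v x b) (lineConfig p v x c) ↔
      (x a - x b) * (x c - x b) < 0 := by
  have h : ∀ i, lineConfig p v x i = AffineMap.lineMap p (p + v) (x i) := fun i => by
    simp [lineConfig, AffineMap.lineMap_apply, add_comm]
  rw [h, h, h, Function.Injective.sbtw_map_iff, sbtw_real_iff]
  exact AffineMap.lineMap_injective ℝ (by simpa using hv)

/-! ### The geometric type of a label -/

/-- The position of a type in the list of types. -/
def PointPattern.index : PointPattern → Fin 9
  | .generalPosition => 0
  | .threeCollinear => 1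
  | .fourCollinear => 2
  | .onePairCoincides => 3
  | .collinearDoubleInMiddle => 4
  | .collinearDoubleAtEnd => 5
  | .threeCoincide => 6
  | .twoPairsCoincide => 7
  | .allCoincide => 8

/-- The position of the type of the configurations with a given label. -/
def Label.typeIndex : Label → Fin 9
  | .inl s => if ∀ i, s i ≠ 0 then 0 else if ∃ i, s i = 0 ∧ ∀ j ≠ i, s j ≠ 0 then 1 else 3
  | .inr r => if ∀ i j, r i = r j → i = j then 2
    else if ∀ i j, r i = r j then 8
    else if ∃ i j k, i ≠ j ∧ j ≠ k ∧ i ≠ k ∧ r i = r j ∧ r j = r k then 6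
    else if ∀ i, ∃ j ≠ i, r i = r j then 7
    -- For a valid label exactly one pair coincides here and the ranks are `0, 1, 2`, so the double
    -- point is in the middle exactly when its rank is `1`.
    else if ∃ i j, i ≠ j ∧ r i = r j ∧ r i = 1 then 4 else 5

theorem PointPattern.index_injective : Function.Injective PointPattern.index := by
  intro a b h
  cases a <;> cases b <;> first | rfl | exact absurd h (by decide)

theorem PointPattern.index_surjective : Function.Surjective PointPattern.index := by
  intro n
  fin_cases n
  exacts [⟨.generalPosition, rfl⟩, ⟨.threeCollinear, rfl⟩, ⟨.fourCollinear, rfl⟩,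
    ⟨.onePairCoincides, rfl⟩, ⟨.collinearDoubleInMiddle, rfl⟩, ⟨.collinearDoubleAtEnd, rfl⟩,
    ⟨.threeCoincide, rfl⟩, ⟨.twoPairsCoincide, rfl⟩, ⟨.allCoincide, rfl⟩]

section NotCollinear

variable {s : Fin 4 → SignType} {P : Configuration (Fin 4) 2}

theorem affDep_eq_zero_iff_of_mem (hP : P ∈ Label.stratum (.inl s)) (i : Fin 4) :
    affDep P i = 0 ↔ s i = 0 := by
  rw [← hP i, sign_eq_zero_iff]

theorem not_collinear_of_mem (hs : Label.IsValid (.inl s)) (hP : P ∈ Label.stratum (.inl s)) :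
    ¬ Collinear ℝ (Set.range P) := by
  rw [collinear_range_iff]
  exact affDep_ne_zero_of_mem hs hP

theorem apply_eq_iff_of_mem_inl (hs : Label.IsValid (.inl s)) (hP : P ∈ Label.stratum (.inl s))
    {i j : Fin 4} (hij : i ≠ j) : P i = P j ↔ ∀ k, k ≠ i → k ≠ j → s k = 0 := by
  simp only [← affDep_eq_zero_iff_of_mem hP]
  exact ⟨fun h k => affDep_eq_zero_of_eq hij h,
    eq_of_affDep_eq_zero (affDep_ne_zero_of_mem hs hP) hij⟩

theorem injective_iff_of_mem_inl (hs : Label.IsValid (.inl s))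
    (hP : P ∈ Label.stratum (.inl s)) :
    Function.Injective P ↔ ∀ i j, i ≠ j → ¬ ∀ k, k ≠ i → k ≠ j → s k = 0 := by
  constructor
  · intro h i j hij hk
    exact hij (h ((apply_eq_iff_of_mem_inl hs hP hij).2 hk))
  · intro h i j hij
    by_contra hne
    exact h i j hne ((apply_eq_iff_of_mem_inl hs hP hne).1 hij)

end NotCollinear

theorem collinear_range_of_subset_line {P : Configuration (Fin 4) 2} {a b c d : Fin 4}
    (hall : ∀ i, i = a ∨ i = b ∨ i = c ∨ i = d) (h : P a = P b)
    (hc : Collinear ℝ {P b, P c, P d}) : Collinear ℝ (Set.range P) := by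
  refine hc.subset ?_
  rintro _ ⟨i, rfl⟩
  rcases hall i with rfl | rfl | rfl | rfl <;> simp [h]

theorem Perm.fin_four_cover (σ : Equiv.Perm (Fin 4)) (i : Fin 4) :
    i = σ 0 ∨ i = σ 1 ∨ i = σ 2 ∨ i = σ 3 := by
  obtain ⟨j, rfl⟩ := σ.surjective i
  fin_cases j <;> simp

theorem mem_generalPosition_iff (P : Configuration (Fin 4) 2) :
    P ∈ PointPattern.generalPosition.locus ↔ ∀ l, affDep P l ≠ 0 := by
  have h1 : ∀ i j k : Fin 4, i ≠ j → j ≠ k → i ≠ k →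
      ∃ l, ∀ m, m ≠ l ↔ m = i ∨ m = j ∨ m = k := by decide
  have h2 : ∀ l : Fin 4, ∃ i j k : Fin 4, i ≠ j ∧ j ≠ k ∧ i ≠ k ∧
      ∀ m, m ≠ l ↔ m = i ∨ m = j ∨ m = k := by decide
  have h3 : ∀ i j k l : Fin 4, (∀ m, m ≠ l ↔ m = i ∨ m = j ∨ m = k) →
      (Collinear ℝ {P i, P j, P k} ↔ affDep P l = 0) := by
    intro i j k l h
    have : ({l}ᶜ : Set (Fin 4)) = {i, j, k} := by ext m; simpa using h m
    rw [← collinear_image_compl_iff, this, Set.image_insert_eq, Set.image_pair]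
  constructor
  · intro h l
    obtain ⟨i, j, k, hij, hjk, hik, hl⟩ := h2 l
    rw [Ne, ← h3 i j k l hl]
    exact h i j k hij hjk hik
  · intro h i j k hij hjk hik
    obtain ⟨l, hl⟩ := h1 i j k hij hjk hik
    rw [h3 i j k l hl]
    exact h l

theorem mem_collinearTriple_iff {s : Fin 4 → SignType} {P : Configuration (Fin 4) 2}
    (hs : Label.IsValid (.inl s)) (hP : P ∈ Label.stratum (.inl s)) (l : Fin 4) :
    P ∈ collinearTriple l ↔ s l = 0 ∧ ∀ k ≠ l, s k ≠ 0 := by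
  -- A second zero entry would leave only two nonzero ones, and the points with those two labels
  -- would coincide.
  have key : ∀ s : Fin 4 → SignType, Label.IsValid (.inl s) → ∀ l,
      ((∀ i j, i ≠ j → ¬ ∀ k, k ≠ i → k ≠ j → s k = 0) ∧ s l = 0 ↔
        s l = 0 ∧ ∀ k ≠ l, s k ≠ 0) := by decide +kernel
  rw [← key s hs l, ← injective_iff_of_mem_inl hs hP, ← affDep_eq_zero_iff_of_mem hP,
    ← collinear_image_compl_iff]
  exact ⟨fun h => ⟨h.1, h.2.1⟩, fun h => ⟨h.1, h.2, not_collinear_of_mem hs hP⟩⟩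

theorem mem_locus_iff_inl {s : Fin 4 → SignType} {P : Configuration (Fin 4) 2}
    (hs : Label.IsValid (.inl s)) (hP : P ∈ Label.stratum (.inl s)) (τ : PointPattern) :
    P ∈ τ.locus ↔ Label.typeIndex (.inl s) = τ.index := by
  have hnc := not_collinear_of_mem hs hP
  have hval : Label.typeIndex (.inl s) = 0 ∨ Label.typeIndex (.inl s) = 1 ∨
      Label.typeIndex (.inl s) = 3 := by
    simp only [Label.typeIndex]
    split_ifs <;> simp
  have hne : ∀ n : Fin 9, n ≠ 0 → n ≠ 1 → n ≠ 3 → Label.typeIndex (.inl s) ≠ n := by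
    rintro n h0 h1 h3 rfl
    tauto
  cases τ
  case generalPosition =>
    have key : ∀ s : Fin 4 → SignType, Label.IsValid (.inl s) →
        ((∀ l, s l ≠ 0) ↔ Label.typeIndex (.inl s) = 0) := by decide +kernel
    rw [mem_generalPosition_iff]
    simp only [Ne, affDep_eq_zero_iff_of_mem hP]
    exact key s hs
  case threeCollinear =>
    have key : ∀ s : Fin 4 → SignType, Label.IsValid (.inl s) →
        ((∃ l, s l = 0 ∧ ∀ k ≠ l, s k ≠ 0) ↔ Label.typeIndex (.inl s) = 1) := by decide +kernel
    simp only [PointPattern.locus, Set.mem_iUnion, mem_collinearTriple_iff hs hP]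
    exact key s hs
  case onePairCoincides =>
    have key : ∀ s : Fin 4 → SignType, Label.IsValid (.inl s) →
        ((∃ i j, i ≠ j ∧ ∀ k, k ≠ i → k ≠ j → s k = 0) ↔ Label.typeIndex (.inl s) = 3) := by
      decide +kernel
    refine Iff.trans ?_ (key s hs)
    refine ⟨?_, ?_⟩
    · rintro ⟨⟨i, j, hij, h⟩, -⟩
      exact ⟨i, j, hij, (apply_eq_iff_of_mem_inl hs hP hij).1 h⟩
    · rintro ⟨i, j, hij, h⟩
      exact ⟨⟨i, j, hij, (apply_eq_iff_of_mem_inl hs hP hij).2 h⟩, hnc⟩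
  all_goals refine iff_of_false ?_ (hne _ (by decide) (by decide) (by decide))
  case fourCollinear => exact fun h => hnc h.2
  case collinearDoubleInMiddle =>
    rintro ⟨σ, h, hb⟩
    refine hnc (collinear_range_of_subset_line (a := σ 1) (b := σ 0) (c := σ 2) (d := σ 3)
      (fun i => ?_) h.symm ?_)
    · have := Perm.fin_four_cover σ i
      tauto
    · rw [Set.insert_comm]
      exact hb.wbtw.collinear
  case collinearDoubleAtEnd =>
    rintro ⟨σ, h, hb⟩
    refine hnc (collinear_range_of_subset_line (a := σ 1) (b := σ 0) (c := σ 2) (d := σ 3)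
      (fun i => ?_) h.symm hb.wbtw.collinear)
    have := Perm.fin_four_cover σ i
    tauto
  case threeCoincide =>
    rintro ⟨σ, h, h', -⟩
    refine hnc (collinear_range_of_subset_line (Perm.fin_four_cover σ) h ?_)
    rw [h', Set.insert_eq_of_mem (Set.mem_insert _ _)]
    exact collinear_pair ℝ _ _
  case twoPairsCoincide =>
    rintro ⟨σ, h, h', -⟩
    refine hnc (collinear_range_of_subset_line (Perm.fin_four_cover σ) h ?_)
    rw [h', Set.pair_eq_singleton]
    exact collinear_pair ℝ _ _
  case allCoincide =>
    intro h
    refine hnc ?_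
    rw [show Set.range P = {P 0} by ext x; simp [fun i => (h i 0), eq_comm]]
    exact collinear_singleton ℝ _

theorem mem_locus_iff_inr {r : Fin 4 → Fin 4} {P : Configuration (Fin 4) 2}
    (hr : Label.IsValid (.inr r)) (hP : P ∈ Label.stratum (.inr r)) (τ : PointPattern) :
    P ∈ τ.locus ↔ Label.typeIndex (.inr r) = τ.index := by
  have ha := affDep_eq_zero_of_mem hP
  have hc := (collinear_range_iff P).2 ha
  have hE : ∀ i j, P i = P j ↔ r i = r j := by
    obtain ⟨p, v, x, hv, hx, rfl⟩ := hP
    intro i j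
    rw [lineConfig_apply_eq_iff hv, eq_iff_of_rankSign_eq hx]
  have hB : ∀ a b c, Sbtw ℝ (P a) (P b) (P c) ↔
      (r a < r b ∧ r b < r c) ∨ (r c < r b ∧ r b < r a) := by
    obtain ⟨p, v, x, hv, hx, rfl⟩ := hP
    intro a b c
    simp only [sbtw_lineConfig_iff hv, lt_iff_of_rankSign_eq hx, mul_neg_iff, sub_pos, sub_neg]
    tauto
  have hval : Label.typeIndex (.inr r) ≠ 0 ∧ Label.typeIndex (.inr r) ≠ 1 ∧
      Label.typeIndex (.inr r) ≠ 3 := by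
    simp only [Label.typeIndex]
    split_ifs <;> decide
  cases τ
  case generalPosition =>
    rw [mem_generalPosition_iff]
    exact iff_of_false (fun h => h 0 (by rw [ha]; rfl)) hval.1
  case threeCollinear =>
    simp only [PointPattern.locus, Set.mem_iUnion]
    exact iff_of_false (fun ⟨l, h⟩ => h.2.2 hc) hval.2.1
  case onePairCoincides => exact iff_of_false (fun h => h.2 hc) hval.2.2
  case fourCollinear =>
    have key : ∀ r : Fin 4 → Fin 4, Label.IsValid (.inr r) →
        ((∀ i j, r i = r j → i = j) ↔ Label.typeIndex (.inr r) = 2) := by decide +kernel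
    refine Iff.trans ⟨fun h i j hij => h.1 ((hE i j).2 hij), fun h => ⟨fun i j hij =>
      h i j ((hE i j).1 hij), hc⟩⟩ (key r hr)
  case collinearDoubleInMiddle =>
    have key : ∀ r : Fin 4 → Fin 4, Label.IsValid (.inr r) →
        ((∃ σ : Equiv.Perm (Fin 4), r (σ 0) = r (σ 1) ∧
          ((r (σ 2) < r (σ 0) ∧ r (σ 0) < r (σ 3)) ∨ (r (σ 3) < r (σ 0) ∧ r (σ 0) < r (σ 2)))) ↔
          Label.typeIndex (.inr r) = 4) := by decide +kernel
    simp only [PointPattern.locus, Set.mem_ofPred_eq, hE, hB]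
    exact key r hr
  case collinearDoubleAtEnd =>
    have key : ∀ r : Fin 4 → Fin 4, Label.IsValid (.inr r) →
        ((∃ σ : Equiv.Perm (Fin 4), r (σ 0) = r (σ 1) ∧
          ((r (σ 0) < r (σ 2) ∧ r (σ 2) < r (σ 3)) ∨ (r (σ 3) < r (σ 2) ∧ r (σ 2) < r (σ 0)))) ↔
          Label.typeIndex (.inr r) = 5) := by decide +kernel
    simp only [PointPattern.locus, Set.mem_ofPred_eq, hE, hB]
    exact key r hr
  case threeCoincide =>
    have key : ∀ r : Fin 4 → Fin 4, Label.IsValid (.inr r) →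
        ((∃ σ : Equiv.Perm (Fin 4), r (σ 0) = r (σ 1) ∧ r (σ 1) = r (σ 2) ∧ ¬ r (σ 2) = r (σ 3)) ↔
          Label.typeIndex (.inr r) = 6) := by decide +kernel
    simp only [PointPattern.locus, Set.mem_ofPred_eq, Ne, hE]
    exact key r hr
  case twoPairsCoincide =>
    have key : ∀ r : Fin 4 → Fin 4, Label.IsValid (.inr r) →
        ((∃ σ : Equiv.Perm (Fin 4), r (σ 0) = r (σ 1) ∧ r (σ 2) = r (σ 3) ∧ ¬ r (σ 1) = r (σ 2)) ↔
          Label.typeIndex (.inr r) = 7) := by decide +kernel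
    simp only [PointPattern.locus, Set.mem_ofPred_eq, Ne, hE]
    exact key r hr
  case allCoincide =>
    have key : ∀ r : Fin 4 → Fin 4, Label.IsValid (.inr r) →
        ((∀ i j, r i = r j) ↔ Label.typeIndex (.inr r) = 8) := by decide +kernel
    simp only [PointPattern.locus, Set.mem_ofPred_eq, hE]
    exact key r hr

theorem mem_locus_iff {l : Label} (hl : l.IsValid) {P : Configuration (Fin 4) 2}
    (hP : P ∈ l.stratum) (τ : PointPattern) : P ∈ τ.locus ↔ l.typeIndex = τ.index := by
  rcases l with s | r
  · exact mem_locus_iff_inl hl hP τ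
  · exact mem_locus_iff_inr hl hP τ

/-- The configurations with label `l` lie in `collinearTriple m`. -/
def Label.IsTriple (m : Fin 4) : Label → Prop
  | .inl s => s m = 0 ∧ ∀ k ≠ m, s k ≠ 0
  | .inr _ => False

instance (m : Fin 4) : DecidablePred (Label.IsTriple m) := fun l => by
  cases l <;> unfold Label.IsTriple <;> infer_instance

theorem mem_collinearTriple_iff_isTriple {l : Label} (hl : l.IsValid)
    {P : Configuration (Fin 4) 2} (hP : P ∈ l.stratum) (m : Fin 4) :
    P ∈ collinearTriple m ↔ l.IsTriple m := by
  rcases l with s | r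
  · exact mem_collinearTriple_iff hl hP m
  · exact iff_of_false (fun h => h.2.2 ((collinear_range_iff P).2 (affDep_eq_zero_of_mem hP)))
      (fun h => h)

/-- The dimension of the fibers over the configurations of a type. -/
def fiberDim : Fin 9 → ℕ := ![1, 1, 3, 1, 3, 3, 3, 3, 6]

theorem finrank_selfStress_of_mem {l : Label} (hl : l.IsValid) {P : Configuration (Fin 4) 2}
    (hP : P ∈ l.stratum) :
    Module.finrank ℝ (selfStress (⊤ : SimpleGraph (Fin 4)) P) = fiberDim l.typeIndex := by
  rcases l with s | r
  · rw [finrank_selfStress_of_not_collinear (affDep_ne_zero_of_mem hl hP)]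
    simp only [Label.typeIndex]
    split_ifs <;> rfl
  · have hall := mem_locus_iff hl hP .allCoincide
    obtain ⟨p, v, x, hv, hx, rfl⟩ := hP
    by_cases h : ∀ i j, x i = x j
    · have hloc : ∀ i j, lineConfig p v x i = lineConfig p v x j := fun i j =>
        (lineConfig_apply_eq_iff hv x i j).2 (h i j)
      rw [hall.1 hloc, selfStress_const _ hloc, finrank_selfStress_zero]
      rfl
    · have hne : Label.typeIndex (.inr r) ≠ 8 := fun e =>
        h fun i j => (lineConfig_apply_eq_iff hv x i j).1 (hall.2 e i j)
      push Not at h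
      rw [finrank_selfStress_lineConfig hv h]
      revert hne
      simp only [Label.typeIndex]
      split_ifs <;> simp [fiberDim]

/-! ### Strata are connected -/

/-- The Euclidean plane. -/
abbrev Plane : Type := EuclideanSpace ℝ (Fin 2)

theorem affDep_eq_cross (P : Configuration (Fin 4) 2) (i : Fin 4) :
    affDep P i = (-1) ^ (i : ℕ) * cross (P (i.succAbove 1) - P (i.succAbove 0))
      (P (i.succAbove 2) - P (i.succAbove 0)) := by
  fin_cases i <;> simp [affDep, Fin.succAbove, Fin.lt_def]
  ring

/-- The affine dependency of three points and an affine combination of them. -/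
theorem affDep_insertNth_succAbove (i : Fin 4) (Q : Fin 3 → Plane)
    {b : Fin 3 → ℝ} (hb : ∑ k, b k = 1) (k : Fin 3) :
    affDep (i.insertNth (∑ k, b k • Q k) Q : Configuration (Fin 4) 2) (i.succAbove k) =
      -b k * affDep (i.insertNth (∑ k, b k • Q k) Q : Configuration (Fin 4) 2) i := by
  have := mul_affDep_comm (P := (i.insertNth (∑ k, b k • Q k) Q : Configuration (Fin 4) 2))
    (c := i.insertNth (-1) b)
    (by rw [Fin.sum_univ_succAbove _ i]; simp [hb])
    (by rw [Fin.sum_univ_succAbove _ i]; simp) i (i.succAbove k)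
  simp only [Fin.insertNth_apply_same, Fin.insertNth_apply_succAbove] at this
  linarith

theorem convex_setOf_sign_eq (t : SignType) : Convex ℝ {x : ℝ | SignType.sign x = t} := by
  rcases t.trichotomy with rfl | rfl | rfl
  · simp only [sign_eq_neg_one_iff]
    exact convex_Iio (0 : ℝ)
  · simp only [sign_eq_zero_iff]
    exact convex_singleton (0 : ℝ)
  · simp only [sign_eq_one_iff]
    exact convex_Ioi (0 : ℝ)

theorem isOpen_setOf_sign_eq {X : Type*} [TopologicalSpace X] {f : X → ℝ} (hf : Continuous f)
    {t : SignType} (ht : t ≠ 0) : IsOpen {x | SignType.sign (f x) = t} := by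
  rcases t.trichotomy with rfl | rfl | rfl
  · simpa only [sign_eq_neg_one_iff] using isOpen_lt hf continuous_const
  · exact absurd rfl ht
  · simpa only [sign_eq_one_iff] using isOpen_lt continuous_const hf

theorem isConnected_compl_zero_plane :
    IsConnected ({0}ᶜ : Set (Plane)) := by
  refine isConnected_compl_singleton_of_one_lt_rank ?_ 0
  rw [← Module.finrank_eq_rank, finrank_euclideanSpace_fin]
  norm_num

theorem exists_sign_eq_one_or_neg_one {t : SignType} (ht : t ≠ 0) :
    {x : ℝ | SignType.sign x = t}.Nonempty := by
  rcases t.trichotomy with rfl | rfl | rfl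
  · exact ⟨-1, by simp⟩
  · exact absurd rfl ht
  · exact ⟨1, by simp⟩

/-- Triangles of a given orientation form a connected set. -/
theorem isConnected_oriented_triangles {t : SignType} (ht : t ≠ 0) :
    IsConnected {Q : Fin 3 → Plane |
      SignType.sign (cross (Q 1 - Q 0) (Q 2 - Q 0)) = t} := by
  -- A triangle is given by a vertex, a nonzero edge vector, and the coordinates of the third vertex
  -- along that edge and along its rotation by a right angle; the orientation is the sign of the
  -- last coordinate.
  let f : Plane × Plane × ℝ × ℝ → Fin 3 → Plane := fun z =>
    ![z.1, z.1 + z.2.1, z.1 + z.2.2.1 • z.2.1 + z.2.2.2 • !₂[-(z.2.1 1), z.2.1 0]]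
  have hf : Continuous f := by
    refine continuous_pi fun k => ?_
    fin_cases k
    · exact continuous_fst
    · exact continuous_fst.add (continuous_fst.comp continuous_snd)
    · change Continuous fun z : Plane × Plane × ℝ × ℝ =>
        z.1 + z.2.2.1 • z.2.1 + z.2.2.2 • !₂[-(z.2.1 1), z.2.1 0]
      fun_prop
  have hn : ∀ u : Plane, u ≠ 0 → 0 < u 0 ^ 2 + u 1 ^ 2 := by
    intro u hu
    by_contra! h
    apply hu
    ext k
    fin_cases k <;> simp <;> nlinarith [sq_nonneg (u 0), sq_nonneg (u 1)]
  have hcr : ∀ z, cross (f z 1 - f z 0) (f z 2 - f z 0) =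
      z.2.2.2 * (z.2.1 0 ^ 2 + z.2.1 1 ^ 2) := by
    intro z
    simp [f, cross]; ring
  have hD : IsConnected ((Set.univ : Set Plane) ×ˢ ({0}ᶜ : Set Plane) ×ˢ (Set.univ : Set ℝ) ×ˢ
      {x : ℝ | SignType.sign x = t}) :=
    isConnected_univ.prod (isConnected_compl_zero_plane.prod (isConnected_univ.prod
      ((convex_setOf_sign_eq t).isConnected (exists_sign_eq_one_or_neg_one ht))))
  convert hD.image f hf.continuousOn using 1
  ext Q
  constructor
  · intro hQ
    have hu : Q 1 - Q 0 ≠ 0 := by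
      intro h
      rw [Set.mem_ofPred_eq, h] at hQ
      exact ht (by simpa [cross] using hQ.symm)
    have hpos := hn _ hu
    set u := Q 1 - Q 0 with hudef
    set w := Q 2 - Q 0 with hwdef
    refine ⟨(Q 0, u, (u 0 * w 0 + u 1 * w 1) / (u 0 ^ 2 + u 1 ^ 2),
      cross u w / (u 0 ^ 2 + u 1 ^ 2)), ⟨trivial, hu, trivial, ?_⟩, ?_⟩
    · change SignType.sign (cross u w / (u 0 ^ 2 + u 1 ^ 2)) = t
      rw [div_eq_mul_inv, sign_mul, sign_pos (inv_pos.2 hpos), mul_one]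
      exact hQ
    · ext k l
      fin_cases k
      · rfl
      · simp [f, hudef]
      · have hw : Q 2 = Q 0 + w := by simp [hwdef]
        simp only [f, Fin.reduceFinMk, Matrix.cons_val]
        rw [hw]
        fin_cases l <;> simp [cross] <;> field_simp <;> ring
  · rintro ⟨z, ⟨-, hz, -, hz'⟩, rfl⟩
    rw [Set.mem_ofPred_eq, hcr, sign_mul, sign_pos (hn _ hz), mul_one]
    exact hz'

/-- Barycentric coordinates with prescribed signs. -/
theorem isConnected_barycentric {t : Fin 3 → SignType} (ht : ∃ k, t k = 1) :
    IsConnected {b : Fin 3 → ℝ | ∑ k, b k = 1 ∧ ∀ k, SignType.sign (b k) = t k} := by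
  refine Convex.isConnected ?_ ?_
  · intro b hb c hc α β hα hβ hαβ
    refine ⟨?_, fun k => convex_setOf_sign_eq (t k) (hb.2 k) (hc.2 k) hα hβ hαβ⟩
    simp [Finset.sum_add_distrib, ← Finset.mul_sum, hb.1, hc.1, hαβ]
  · obtain ⟨k₀, hk₀⟩ := ht
    have hs : ∀ s : SignType, SignType.sign ((s : ℝ) / 4) = s ∧ (s : ℝ) ≤ 1 := by
      intro s
      rcases s.trichotomy with rfl | rfl | rfl
      · refine ⟨?_, by simp⟩
        rw [sign_eq_neg_one_iff]; norm_num
      · simp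
      · refine ⟨?_, by simp⟩
        rw [sign_eq_one_iff]; norm_num
    -- All coordinates but `k₀` are `0` or `±1/4`, so the remainder left for `k₀` is at least `1/2`,
    -- which has the required positive sign.
    refine ⟨Function.update (fun k => (t k : ℝ) / 4) k₀
      (1 - ∑ k ∈ Finset.univ.erase k₀, (t k : ℝ) / 4), ?_, fun k => ?_⟩
    · rw [← Finset.add_sum_erase _ _ (Finset.mem_univ k₀), Function.update_self,
        Finset.sum_congr rfl (fun k hk => Function.update_of_ne (Finset.ne_of_mem_erase hk) _ _)]
      ring
    · by_cases h : k = k₀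
      · subst h
        rw [Function.update_self, hk₀, sign_eq_one_iff]
        have : ∑ j ∈ Finset.univ.erase k, (t j : ℝ) / 4 ≤ ∑ j ∈ Finset.univ.erase k, 1 / 4 :=
          Finset.sum_le_sum fun j _ => by linarith [(hs (t j)).2]
        rw [Finset.sum_const, Finset.card_erase_of_mem (Finset.mem_univ k), Finset.card_univ,
          Fintype.card_fin, nsmul_eq_mul] at this
        norm_num at this ⊢
        linarith
      · rw [Function.update_of_ne h]
        exact (hs (t k)).1

theorem insertNth_removeNth_of_sum {P : Configuration (Fin 4) 2} {i : Fin 4}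
    (hi : affDep P i ≠ 0) {b : Fin 3 → ℝ}
    (hb : ∀ k, b k = -affDep P (i.succAbove k) / affDep P i) :
    (i.insertNth (∑ k, b k • P (i.succAbove k)) (fun k => P (i.succAbove k)) :
      Configuration (Fin 4) 2) = P := by
  have h := sum_affDep_smul P
  rw [Fin.sum_univ_succAbove _ i] at h
  have h1 : ∑ k, b k • P (i.succAbove k) = P i := by
    have h2 : affDep P i • ∑ k, b k • P (i.succAbove k) = affDep P i • P i := by
      rw [Finset.smul_sum, eq_neg_of_add_eq_zero_left h, ← Finset.sum_neg_distrib]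
      refine Finset.sum_congr rfl fun k _ => ?_
      rw [smul_smul, hb, mul_div_cancel₀ _ hi, neg_smul]
    exact smul_right_injective _ hi h2
  rw [h1]
  exact Fin.insertNth_self_removeNth i P

theorem sum_barycentric {P : Configuration (Fin 4) 2} {i : Fin 4}
    (hi : affDep P i ≠ 0) : ∑ k, -affDep P (i.succAbove k) / affDep P i = 1 := by
  have h := sum_affDep P
  rw [Fin.sum_univ_succAbove _ i] at h
  rw [← Finset.sum_div, Finset.sum_neg_distrib, div_eq_one_iff_eq hi]
  linarith

theorem sign_neg_div (x y : ℝ) :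
    SignType.sign (-x / y) = -(SignType.sign x * SignType.sign y) := by
  rw [div_eq_mul_inv, sign_mul, Left.sign_neg, neg_mul]
  congr 2
  rcases lt_trichotomy y 0 with h | rfl | h
  · rw [sign_neg h, sign_neg (inv_lt_zero.2 h)]
  · simp
  · rw [sign_pos h, sign_pos (inv_pos.2 h)]

/-- Choose `i` with `s i = 1`. The other three points form a triangle of fixed orientation, and the
point `i` has barycentric coordinates `-a k / a i` of fixed signs with respect to it. A negative
entry of `s` makes one of these signs positive, so suitable coordinates of sum 1 exist. -/
theorem isConnected_stratum_inl {s : Fin 4 → SignType} (hs : Label.IsValid (.inl s)) :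
    IsConnected (Label.stratum (.inl s)) := by
  obtain ⟨⟨i, hi⟩, ⟨j, hj⟩⟩ := hs
  obtain ⟨k, rfl⟩ := Fin.exists_succAbove_eq (x := j) (y := i) (by
    rintro rfl; rw [hi] at hj; exact absurd hj (by decide))
  have hsi : SignType.sign ((-1 : ℝ) ^ (i : ℕ)) ≠ 0 := by simp
  have hT := isConnected_oriented_triangles (t := SignType.sign ((-1 : ℝ) ^ (i : ℕ))) hsi
  have hB := isConnected_barycentric (t := fun k => -s (i.succAbove k)) ⟨k, by simp [hj]⟩
  let f : (Fin 3 → Plane) × (Fin 3 → ℝ) → Configuration (Fin 4) 2 :=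
    fun z => i.insertNth (∑ k, z.2 k • z.1 k) z.1
  have hf : Continuous f := Continuous.finInsertNth i (by fun_prop) continuous_fst
  convert (hT.prod hB).image f hf.continuousOn using 1
  ext P
  constructor
  · intro hP
    have hpos : 0 < affDep P i := by rw [← sign_eq_one_iff, hP i, hi]
    refine ⟨(fun k => P (i.succAbove k), fun k => -affDep P (i.succAbove k) / affDep P i),
      ⟨?_, sum_barycentric hpos.ne', fun k => ?_⟩,
      insertNth_removeNth_of_sum hpos.ne' fun k => rfl⟩
    · have h := hP i
      rw [hi, affDep_eq_cross, sign_mul] at h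
      change SignType.sign (cross _ _) = _
      revert h
      generalize SignType.sign (cross _ _) = a
      generalize SignType.sign ((-1 : ℝ) ^ (i : ℕ)) = b
      revert a b
      decide
    · rw [sign_neg_div, hP, hP, hi, mul_one]
  · rintro ⟨⟨Q, b⟩, ⟨hQ, hb, hb'⟩, rfl⟩
    have h1 : SignType.sign (affDep (f (Q, b)) i) = 1 := by
      rw [affDep_eq_cross, sign_mul]
      simp only [f, Fin.insertNth_apply_succAbove]
      rw [show SignType.sign (cross (Q 1 - Q 0) (Q 2 - Q 0)) = _ from hQ, ← sign_mul, sign_eq_one_iff]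
      exact mul_self_pos.2 (by simp)
    intro l
    rcases Fin.eq_self_or_eq_succAbove i l with rfl | ⟨k, rfl⟩
    · rw [h1, hi]
    · rw [show f (Q, b) = i.insertNth (∑ k, b k • Q k) Q from rfl,
        affDep_insertNth_succAbove i Q hb, sign_mul, Left.sign_neg, hb' k]
      change - -s _ * SignType.sign (affDep (f (Q, b)) i) = _
      rw [h1, neg_neg, mul_one]

/-- The coordinates with a given order form a convex set, and the nonzero directions form a
punctured plane. -/
theorem isConnected_stratum_inr (r : Fin 4 → Fin 4) :
    IsConnected (Label.stratum (.inr r)) := by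
  let C : Set (Fin 4 → ℝ) := {x | ∀ i j, SignType.sign (x i - x j) = rankSign r i j}
  have hC : IsConnected C := by
    refine Convex.isConnected ?_ ⟨fun i => ((r i : ℕ) : ℝ), rankSign_eq_of_lt_iff fun i j => ?_⟩
    · intro x hx y hy α β hα hβ hαβ i j
      have := convex_setOf_sign_eq (rankSign r i j) (hx i j) (hy i j) hα hβ hαβ
      rw [Set.mem_ofPred_eq] at this
      rw [← this]
      congr 1
      simp only [Pi.add_apply, Pi.smul_apply, smul_eq_mul]
      ring
    · rw [Nat.cast_lt, Fin.lt_def]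
  let f : Plane × Plane × (Fin 4 → ℝ) → Configuration (Fin 4) 2 := fun z => lineConfig z.1 z.2.1 z.2.2
  have hf : Continuous f := by
    refine continuous_pi fun i => ?_
    change Continuous fun z : Plane × Plane × (Fin 4 → ℝ) => z.1 + z.2.2 i • z.2.1
    fun_prop
  convert (isConnected_univ.prod (isConnected_compl_zero_plane.prod hC)).image f
    hf.continuousOn using 1
  ext P
  constructor
  · rintro ⟨p, v, x, hv, hx, rfl⟩
    exact ⟨(p, v, x), ⟨trivial, hv, hx⟩, rfl⟩
  · rintro ⟨⟨p, v, x⟩, ⟨-, hv, hx⟩, rfl⟩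
    exact ⟨p, v, x, hv, hx, rfl⟩

theorem isConnected_stratum {l : Label} (hl : l.IsValid) : IsConnected l.stratum := by
  rcases l with s | r
  · exact isConnected_stratum_inl hl
  · exact isConnected_stratum_inr r

/-- Each label set qualifies as connected with equivalent fibers, and by `subset_stratum` it
contains every such set that it meets. -/
theorem isStratum_iff {S : Set (Configuration (Fin 4) 2)} :
    IsStratum (⊤ : SimpleGraph (Fin 4)) S ↔ ∃ l : Label, l.IsValid ∧ S = l.stratum := by
  constructor
  · intro h
    obtain ⟨P, hPS⟩ := h.prop.1.nonempty
    obtain ⟨l, hl, hP⟩ := exists_label P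
    refine ⟨l, hl, h.eq_of_subset ?_ (subset_stratum hl h.prop.1.isPreconnected h.prop.2 hPS hP)⟩
    exact ⟨isConnected_stratum hl, fun P hP Q hQ => fiberEquiv_of_mem_stratum hl hP hQ⟩
  · rintro ⟨l, hl, rfl⟩
    refine ⟨⟨isConnected_stratum hl, fun P hP Q hQ => fiberEquiv_of_mem_stratum hl hP hQ⟩, ?_⟩
    intro A hA hlA
    obtain ⟨P, hP⟩ := (isConnected_stratum hl).nonempty
    exact subset_stratum hl hA.1.isPreconnected hA.2 (hlA hP) hP

/-! ### Dimensions of the strata -/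

/-- A set with a `C¹` parametrization by an open set and a `C¹` coordinate map has the dimension
of the parameter space. -/
theorem dimH_eq_finrank_of_parametrization {E F : Type*} [NormedAddCommGroup E]
    [NormedSpace ℝ E] [FiniteDimensional ℝ E] [NormedAddCommGroup F] [NormedSpace ℝ F]
    [FiniteDimensional ℝ F] {S : Set E} {U : Set F} (hU : IsOpen U) (hne : S.Nonempty)
    {f : F → E} {g : E → F} (hf : ContDiff ℝ 1 f) (hg : ∀ x ∈ S, ContDiffAt ℝ 1 g x)
    (hSf : ∀ x ∈ S, g x ∈ U ∧ f (g x) = x) (hUg : ∀ u ∈ U, f u ∈ S ∧ g (f u) = u) :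
    dimH S = Module.finrank ℝ F := by
  have : ProperSpace E := FiniteDimensional.proper ℝ E
  apply le_antisymm
  -- Upper bound: `S` lies in the range of the `C¹` map `f`.
  · refine le_trans (dimH_mono ?_) hf.dimH_range_le
    intro x hx
    exact ⟨g x, (hSf x hx).2⟩
  · obtain ⟨x, hx⟩ := hne
    -- Lower bound: the open set `U` has full dimension and lies in `g '' S`, and the locally
    -- Lipschitz map `g` does not raise dimension.
    rw [← Real.dimH_of_mem_nhds (hU.mem_nhds (hSf x hx).1)]
    refine le_trans (dimH_mono (t := g '' S) fun u hu => ⟨f u, (hUg u hu).1, (hUg u hu).2⟩) ?_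
    refine dimH_image_le_of_locally_lipschitzOn fun y hy => ?_
    obtain ⟨K, t, ht, hK⟩ := (hg y hy).exists_lipschitzOnWith
    exact ⟨K, t, mem_nhdsWithin_of_mem_nhds ht, hK⟩

/-- The dimension of the strata of a type. -/
def typeDim : Fin 9 → ℕ := ![8, 7, 6, 6, 5, 5, 4, 4, 2]

/-- Barycentric coordinates summing to one, given by the coordinates with index in a subtype not
containing `j`. -/
def completeBary (j : Fin 3) (p : Fin 3 → Prop) [DecidablePred p]
    (b : {k : Fin 3 // k ≠ j ∧ p k} → ℝ) (k : Fin 3) : ℝ :=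
  if h : k ≠ j ∧ p k then b ⟨k, h⟩ else if k = j then 1 - ∑ z, b z else 0

theorem sum_completeBary (j : Fin 3) (p : Fin 3 → Prop) [DecidablePred p]
    (b : {k : Fin 3 // k ≠ j ∧ p k} → ℝ) : ∑ k, completeBary j p b k = 1 := by
  have h1 : ∑ k ∈ Finset.univ.erase j, completeBary j p b k = ∑ z, b z := by
    have h2 : ∑ z, b z = ∑ z : {k : Fin 3 // k ≠ j ∧ p k}, completeBary j p b z := by
      refine Finset.sum_congr rfl fun z _ => ?_
      rw [completeBary, dif_pos z.2]
    rw [h2, ← Finset.sum_subtype (Finset.univ.filter fun k => k ≠ j ∧ p k) (by simp)]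
    symm
    refine Finset.sum_subset (fun k hk => ?_) fun k hk hk' => ?_
    · simp at hk; simp [hk.1]
    · simp at hk hk'
      simp [completeBary, hk, hk']
  rw [← Finset.add_sum_erase _ _ (Finset.mem_univ j), h1]
  simp [completeBary]

theorem completeBary_eq {j : Fin 3} {p : Fin 3 → Prop} [DecidablePred p] {c : Fin 3 → ℝ}
    (hc : ∑ k, c k = 1) (h0 : ∀ k, k ≠ j → ¬ p k → c k = 0) :
    completeBary j p (fun z => c z) = c := by
  have h1 : ∀ k, k ≠ j → completeBary j p (fun z => c z) k = c k := by
    intro k hk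
    by_cases hp : p k
    · simp [completeBary, hk, hp]
    · simp [completeBary, hk, hp, h0 k hk hp]
  have h2 := sum_completeBary j p (fun z => c z)
  ext k
  by_cases hk : k = j
  · subst hk
    rw [← hc, ← Finset.add_sum_erase _ _ (Finset.mem_univ k),
      ← Finset.add_sum_erase _ c (Finset.mem_univ k),
      Finset.sum_congr rfl fun i hi => h1 i (Finset.ne_of_mem_erase hi)] at h2
    exact add_right_cancel h2
  · exact h1 k hk

theorem contDiff_completeBary (j : Fin 3) (p : Fin 3 → Prop) [DecidablePred p] (k : Fin 3) :
    ContDiff ℝ 1 fun b => completeBary j p b k := by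
  unfold completeBary
  split_ifs <;> fun_prop

/-- The parameters are the triangle of the points other than `i` (six real numbers) and the
barycentric coordinates of the point `i` that are free: those at zeros of `s` vanish, and the one at
`j` is determined by the sum 1. -/
theorem dimH_stratum_inl {s : Fin 4 → SignType} (hs : Label.IsValid (.inl s)) :
    dimH (Label.stratum (.inl s)) = typeDim (Label.typeIndex (.inl s)) := by
  have hne := (isConnected_stratum hs).nonempty
  obtain ⟨i, hi⟩ := hs.1
  obtain ⟨j', hj'⟩ := hs.2
  obtain ⟨j, rfl⟩ := Fin.exists_succAbove_eq (x := j') (y := i) (by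
    rintro rfl; rw [hi] at hj'; exact absurd hj' (by decide))
  let p : Fin 3 → Prop := fun k => s (i.succAbove k) ≠ 0
  let Z := {k : Fin 3 // k ≠ j ∧ p k}
  have hcard : ∀ s : Fin 4 → SignType, Label.IsValid (.inl s) → ∀ (i : Fin 4) (j : Fin 3),
      s i = 1 → s (i.succAbove j) = -1 →
      6 + (Finset.univ.filter fun k : Fin 3 => k ≠ j ∧ s (i.succAbove k) ≠ 0).card =
        typeDim (Label.typeIndex (.inl s)) := by decide +kernel
  rw [← hcard s hs i j hi hj']
  let f : (Fin 3 → Plane) × (Z → ℝ) → Configuration (Fin 4) 2 :=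
    fun z => i.insertNth (∑ k, completeBary j p z.2 k • z.1 k) z.1
  let g : Configuration (Fin 4) 2 → (Fin 3 → Plane) × (Z → ℝ) :=
    fun P => (fun k => P (i.succAbove k), fun z => -affDep P (i.succAbove z) / affDep P i)
  have hf : ContDiff ℝ 1 f := by
    refine contDiff_pi' fun l => ?_
    rcases Fin.eq_self_or_eq_succAbove i l with rfl | ⟨k, rfl⟩
    · simp only [f, Fin.insertNth_apply_same]
      have h : ∀ k, ContDiff ℝ 1 fun z : (Fin 3 → Plane) × (Z → ℝ) => z.1 k := by fun_prop
      exact ContDiff.sum fun k _ => ((contDiff_completeBary j p k).comp contDiff_snd).smul (h k)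
    · simp only [f, Fin.insertNth_apply_succAbove]
      fun_prop
  have hbary : ∀ z k, affDep (f z) (i.succAbove k) = -completeBary j p z.2 k * affDep (f z) i :=
    fun z k => affDep_insertNth_succAbove i z.1 (sum_completeBary j p z.2) k
  have hzero : ∀ z l, s l = 0 → affDep (f z) l = 0 := by
    intro z l hl
    rcases Fin.eq_self_or_eq_succAbove i l with rfl | ⟨k, rfl⟩
    · rw [hi] at hl; exact absurd hl (by decide)
    · rw [hbary]
      have hkj : k ≠ j := by rintro rfl; rw [hj'] at hl; exact absurd hl (by decide)
      simp [completeBary, p, hl, hkj]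
  have hpos : ∀ P ∈ Label.stratum (.inl s), affDep P i ≠ 0 := by
    intro P hP
    rw [← sign_ne_zero, hP i, hi]
    decide
  -- The vanishing conditions hold on the whole range of `f`, so only strict inequalities are left.
  have hU : IsOpen (f ⁻¹' Label.stratum (.inl s)) := by
    have : f ⁻¹' Label.stratum (.inl s) =
        ⋂ l : Fin 4, {z | s l ≠ 0 → SignType.sign (affDep (f z) l) = s l} := by
      ext z
      simp only [Set.mem_iInter]
      refine ⟨fun h l _ => h l, fun h l => ?_⟩
      by_cases hl : s l = 0
      · rw [hl, hzero z l hl, sign_zero]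
      · exact h l hl
    rw [this]
    refine isOpen_iInter_of_finite fun l => ?_
    by_cases hl : s l = 0
    · simp [hl]
    · simpa [hl] using
        isOpen_setOf_sign_eq ((continuous_apply l).comp (continuous_affDep.comp hf.continuous)) hl
  have hfg : ∀ P ∈ Label.stratum (.inl s), f (g P) = P := by
    intro P hP
    have hb : completeBary j p (g P).2 = fun k => -affDep P (i.succAbove k) / affDep P i := by
      refine completeBary_eq (sum_barycentric (hpos P hP)) fun k _ hk => ?_
      have : affDep P (i.succAbove k) = 0 := by
        rw [← sign_eq_zero_iff, hP]
        exact not_not.1 hk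
      rw [this, neg_zero, zero_div]
    simp only [f, hb]
    exact insertNth_removeNth_of_sum (hpos P hP) fun k => rfl
  rw [dimH_eq_finrank_of_parametrization hU hne hf (g := g) ?_ ?_ ?_]
  · rw [Module.finrank_prod, Module.finrank_pi_fintype, Module.finrank_fintype_fun_eq_card,
      Fintype.card_subtype]
    simp [p]
  · intro P hP
    refine ContDiffAt.prodMk (by fun_prop) (contDiffAt_pi.2 fun z => ?_)
    exact ((contDiff_affDep _).contDiffAt.neg).div (contDiff_affDep i).contDiffAt (hpos P hP)
  · intro P hP
    refine ⟨?_, hfg P hP⟩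
    rw [Set.mem_preimage, hfg P hP]
    exact hP
  · intro z hz
    refine ⟨hz, Prod.ext (funext fun k => ?_) (funext fun k => ?_)⟩
    · simp [g, f]
    · change -affDep (f z) _ / affDep (f z) i = _
      rw [hbary, neg_mul, neg_neg, mul_div_cancel_right₀ _ (hpos _ hz), completeBary, dif_pos k.2]

theorem rankSign_eq_iff_lt_iff {x : Fin 4 → ℝ} {r : Fin 4 → Fin 4} :
    (∀ i j, SignType.sign (x i - x j) = rankSign r i j) ↔ ∀ i j, r i < r j ↔ x i < x j :=
  ⟨lt_iff_of_rankSign_eq, rankSign_eq_of_lt_iff⟩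

/-- Coordinates of points on a line of which the first two are `0` and `1`. -/
def normCoord {n : ℕ} (t : Fin n → ℝ) : Fin (n + 2) → ℝ := Fin.cons 0 (Fin.cons 1 t)

theorem contDiff_normCoord {n : ℕ} (k : Fin (n + 2)) :
    ContDiff ℝ 1 fun t : Fin n → ℝ => normCoord t k := by
  refine Fin.cases ?_ (fun k => Fin.cases ?_ (fun k => ?_) k) k
  · exact contDiff_const
  · exact contDiff_const
  · exact contDiff_apply ℝ ℝ k

theorem normCoord_normalize {n : ℕ} {y : Fin (n + 2) → ℝ} (h : y 1 ≠ y 0) :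
    normCoord (fun k : Fin n => (y k.succ.succ - y 0) / (y 1 - y 0)) =
      fun k => (y k - y 0) / (y 1 - y 0) := by
  ext k
  refine Fin.cases ?_ (fun k => Fin.cases ?_ (fun k => ?_) k) k
  · simp [normCoord]
  · have : y 1 - y 0 ≠ 0 := sub_ne_zero.2 h
    simp [normCoord, this]
  · simp [normCoord]

open scoped RealInnerProductSpace in
/-- The dimension of the set of four points with `n + 2` positions on a line. -/
theorem dimH_stratum_inr_of_surjective {n : ℕ} {r : Fin 4 → Fin 4} {ρ : Fin 4 → Fin (n + 2)}
    (hρ : Function.Surjective ρ) (hr : ∀ i j, r i < r j ↔ ρ i < ρ j) :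
    dimH (Label.stratum (.inr r)) = (n + 4 : ℕ) := by
  have hne := (isConnected_stratum_inr r).nonempty
  -- `ι k` is the label of some point at position `k`. Scaling the direction so that the first two
  -- positions have coordinates `0` and `1` makes the parameters unique; inner products recover the
  -- other coordinates.
  obtain ⟨ι, hι⟩ := hρ.hasRightInverse
  let f : Plane × Plane × (Fin n → ℝ) → Configuration (Fin 4) 2 := fun z =>
    lineConfig z.1 z.2.1 fun i => normCoord z.2.2 (ρ i)
  let g : Configuration (Fin 4) 2 → Plane × Plane × (Fin n → ℝ) := fun P =>
    (P (ι 0), P (ι 1) - P (ι 0), fun k => ⟪P (ι 1) - P (ι 0), P (ι k.succ.succ) - P (ι 0)⟫ /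
      ⟪P (ι 1) - P (ι 0), P (ι 1) - P (ι 0)⟫)
  let U : Set (Plane × Plane × (Fin n → ℝ)) := {z | z.2.1 ≠ 0 ∧ StrictMono (normCoord z.2.2)}
  have hf : ContDiff ℝ 1 f := by
    refine contDiff_pi' fun i => ?_
    change ContDiff ℝ 1 fun z : Plane × Plane × (Fin n → ℝ) => z.1 + normCoord z.2.2 (ρ i) • z.2.1
    exact contDiff_fst.add (((contDiff_normCoord (ρ i)).comp
      (contDiff_snd.comp contDiff_snd)).smul (contDiff_fst.comp contDiff_snd))
  have hU : IsOpen U := by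
    have : U = {z | z.2.1 ≠ 0} ∩ ⋂ a, ⋂ b, {z | a < b → normCoord z.2.2 a < normCoord z.2.2 b} := by
      ext z
      simp only [U, Set.mem_inter_iff, Set.mem_iInter]
      exact Iff.rfl
    rw [this]
    refine IsOpen.inter (isOpen_ne_fun (by fun_prop) continuous_const)
      (isOpen_iInter_of_finite fun a => isOpen_iInter_of_finite fun b => ?_)
    by_cases h : a < b
    · simp only [h, true_imp_iff]
      exact isOpen_lt ((contDiff_normCoord a).continuous.comp (by fun_prop))
        ((contDiff_normCoord b).continuous.comp (by fun_prop))
    · simp [h]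
  have hS : ∀ P ∈ Label.stratum (.inr r), ∃ p v, ∃ y : Fin (n + 2) → ℝ, v ≠ 0 ∧ StrictMono y ∧
      P = lineConfig p v fun i => y (ρ i) := by
    rintro P ⟨p, v, x, hv, hx, rfl⟩
    rw [rankSign_eq_iff_lt_iff] at hx
    refine ⟨p, v, fun k => x (ι k), hv, fun a b hab => ?_, ?_⟩
    · rw [← hx, hr, hι, hι]; exact hab
    · congr 1
      ext i
      have h1 : ∀ i j, ρ i = ρ j → x i = x j := by
        intro i j h
        refine le_antisymm (not_lt.1 ?_) (not_lt.1 ?_) <;> rw [← hx, hr, h] <;> exact lt_irrefl _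
      exact h1 _ _ (hι (ρ i)).symm
  have hgf : ∀ p v (y : Fin (n + 2) → ℝ), v ≠ 0 → StrictMono y →
      g (lineConfig p v fun i => y (ρ i)) = (p + y 0 • v, (y 1 - y 0) • v,
        fun k => (y k.succ.succ - y 0) / (y 1 - y 0)) := by
    intro p v y hv hy
    have h0 : y 1 - y 0 ≠ 0 := (sub_pos.2 (hy (by simp))).ne'
    have h1 : ⟪v, v⟫ ≠ 0 := inner_self_ne_zero.2 hv
    have h2 : ∀ k l, lineConfig p v (fun i => y (ρ i)) (ι k) -
        lineConfig p v (fun i => y (ρ i)) (ι l) = (y k - y l) • v := by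
      intro k l
      rw [sub_smul]
      simp [lineConfig, hι k, hι l]
    refine Prod.ext ?_ (Prod.ext ?_ (funext fun k => ?_))
    · simp [g, lineConfig, hι 0]
    · exact h2 1 0
    · simp only [g, h2, inner_smul_left, inner_smul_right, RCLike.conj_to_real]
      field_simp
  rw [dimH_eq_finrank_of_parametrization hU hne hf (g := g) ?_ ?_ ?_]
  · simp [Module.finrank_prod]
    ring
  · intro P hP
    obtain ⟨p, v, y, hv, hy, rfl⟩ := hS P hP
    have h0 : y 1 - y 0 ≠ 0 := (sub_pos.2 (hy (by simp))).ne'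
    have h2 : ∀ k, ContDiff ℝ 1 fun P : Configuration (Fin 4) 2 => P (ι k) - P (ι 0) := by
      intro k; fun_prop
    refine ContDiffAt.prodMk (by fun_prop) (ContDiffAt.prodMk (by fun_prop)
      (contDiffAt_pi.2 fun k => ?_))
    refine ContDiffAt.div ((h2 1).inner ℝ (h2 _)).contDiffAt
      ((h2 1).inner ℝ (h2 1)).contDiffAt ?_
    change ⟪(g _).2.1, (g _).2.1⟫ ≠ 0
    rw [inner_self_ne_zero]
    rw [hgf p v y hv hy]
    exact smul_ne_zero h0 hv
  · intro P hP
    obtain ⟨p, v, y, hv, hy, rfl⟩ := hS P hP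
    have h0 : 0 < y 1 - y 0 := sub_pos.2 (hy (by simp))
    have hn := normCoord_normalize (sub_ne_zero.1 h0.ne')
    rw [hgf p v y hv hy]
    refine ⟨⟨smul_ne_zero h0.ne' hv, ?_⟩, ?_⟩
    · change StrictMono (normCoord fun k => (y k.succ.succ - y 0) / (y 1 - y 0))
      rw [hn]
      intro a b hab
      have := hy hab
      change (y a - y 0) / _ < (y b - y 0) / _
      gcongr
    · ext1 i
      simp only [f, lineConfig, hn]
      rw [smul_smul, div_mul_cancel₀ _ h0.ne', add_assoc, ← add_smul]
      congr 2
      ring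
  · rintro ⟨p, v, t⟩ ⟨hv, ht⟩
    refine ⟨⟨p, v, _, hv, rankSign_eq_iff_lt_iff.2 fun i j => ?_, rfl⟩, ?_⟩
    · rw [hr]
      exact ht.lt_iff_lt.symm
    · change g (lineConfig p v fun i => normCoord t (ρ i)) = _
      rw [hgf p v _ hv ht]
      simp [show normCoord t 0 = 0 from rfl, show normCoord t 1 = 1 from rfl,
        show ∀ k : Fin n, normCoord t k.succ.succ = t k from fun _ => rfl]

theorem dimH_stratum_inr_of_const {r : Fin 4 → Fin 4} (hr : ∀ i j, r i = r j) :
    dimH (Label.stratum (.inr r)) = 2 := by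
  have hne := (isConnected_stratum_inr r).nonempty
  have hS : ∀ P ∈ Label.stratum (.inr r), ∀ i, P i = P 0 := by
    rintro P ⟨p, v, x, hv, hx, rfl⟩ i
    rw [lineConfig_apply_eq_iff hv, ← eq_iff_of_rankSign_eq hx]
    exact hr i 0
  rw [dimH_eq_finrank_of_parametrization (F := Plane) isOpen_univ hne (f := fun p _ => p)
    (g := fun P => P 0) (by fun_prop) (fun P _ => by fun_prop)
    (fun P hP => ⟨trivial, funext fun i => (hS P hP i).symm⟩) fun p _ => ⟨?_, rfl⟩]
  · simp
  · obtain ⟨v, hv⟩ := exists_ne (0 : Plane)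
    exact ⟨p, v, 0, hv, rankSign_eq_iff_lt_iff.2 fun i j => by simp [hr i j],
      funext fun i => by simp [lineConfig]⟩

theorem dimH_stratum {l : Label} (hl : l.IsValid) :
    dimH l.stratum = typeDim l.typeIndex := by
  rcases l with s | r
  · exact dimH_stratum_inl hl
  -- Valid ranks fill an initial segment, so nonconstant ones map onto `n + 2` consecutive
  -- positions.
  · have key : ∀ r : Fin 4 → Fin 4, Label.IsValid (.inr r) →
        ((∀ i j, r i = r j) ∧ typeDim (Label.typeIndex (.inr r)) = 2) ∨
        ∃ n : Fin 3, n + 4 = typeDim (Label.typeIndex (.inr r)) ∧ (∀ i, (r i : ℕ) < n + 2) ∧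
          ∀ k : Fin 4, (k : ℕ) < n + 2 → ∃ i, r i = k := by decide +kernel
    rcases key r hl with ⟨h1, h2⟩ | ⟨n, h1, h2, h3⟩
    · rw [dimH_stratum_inr_of_const h1, h2]
      norm_num
    · rw [← h1]
      refine dimH_stratum_inr_of_surjective (ρ := fun i => ⟨r i, h2 i⟩) (fun k => ?_)
        fun i j => Iff.rfl
      obtain ⟨i, hi⟩ := h3 ⟨k, by omega⟩ k.2
      exact ⟨i, Fin.ext (by simp [hi])⟩

/-! ### Counting -/

/-- Distinct valid labels give distinct strata, since label sets are nonempty and a configuration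
has only one valid label. -/
theorem encard_strata (p : Label → Prop) [DecidablePred p] {A : Set (Set (Configuration (Fin 4) 2))}
    (hA : ∀ S, S ∈ A ↔ ∃ l : Label, (l.IsValid ∧ p l) ∧ S = l.stratum) :
    A.encard = (Finset.univ.filter fun l : Label => l.IsValid ∧ p l).card := by
  have : A = Label.stratum '' {l | l.IsValid ∧ p l} := by
    ext S
    rw [hA]
    exact exists_congr fun l => and_congr_right fun _ => eq_comm
  rw [this, Set.InjOn.encard_image, ← Set.encard_coe_eq_coe_finsetCard]
  · simp
  · rintro l ⟨hl, -⟩ l' ⟨hl', -⟩ h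
    obtain ⟨P, hP⟩ := (isConnected_stratum hl).nonempty
    exact label_unique hl hl' hP (by rwa [← h])

/-- Once membership in `T` depends only on the label, all claims about strata become decidable
statements about labels. -/
theorem consistsOfStrata_of_label {T : Set (Configuration (Fin 4) 2)} (p : Label → Prop)
    [DecidablePred p] (hT : ∀ l : Label, l.IsValid → ∀ P ∈ l.stratum, P ∈ T ↔ p l) {N k f : ℕ}
    (hN : (Finset.univ.filter fun l : Label => l.IsValid ∧ p l).card = N)
    (hk : ∀ l : Label, l.IsValid → p l → typeDim l.typeIndex = k)
    (hf : ∀ l : Label, l.IsValid → p l → fiberDim l.typeIndex = f) :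
    ConsistsOfStrata T N k f := by
  have hsub : ∀ l : Label, l.IsValid → (l.stratum ⊆ T ↔ p l) := by
    intro l hl
    obtain ⟨P, hP⟩ := (isConnected_stratum hl).nonempty
    exact ⟨fun h => (hT l hl P hP).1 (h hP), fun h Q hQ => (hT l hl Q hQ).2 h⟩
  refine ⟨?_, ?_, ?_, ?_, ?_⟩
  · rintro S hS ⟨P, hPS, hPT⟩
    obtain ⟨l, hl, rfl⟩ := isStratum_iff.1 hS
    exact (hsub l hl).2 ((hT l hl P hPS).1 hPT)
  · intro P _
    obtain ⟨l, hl, hP⟩ := exists_label P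
    exact ⟨_, isStratum_iff.2 ⟨l, hl, rfl⟩, hP⟩
  · rw [← hN]
    refine encard_strata p fun S => ?_
    rw [Set.mem_ofPred_eq, isStratum_iff]
    constructor
    · rintro ⟨⟨l, hl, rfl⟩, h⟩
      exact ⟨l, ⟨hl, (hsub l hl).1 h⟩, rfl⟩
    · rintro ⟨l, ⟨hl, h⟩, rfl⟩
      exact ⟨⟨l, hl, rfl⟩, (hsub l hl).2 h⟩
  · intro S hS hST
    obtain ⟨l, hl, rfl⟩ := isStratum_iff.1 hS
    rw [stratumDim, dimH_stratum hl, hk l hl ((hsub l hl).1 hST)]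
  · intro P hP
    obtain ⟨l, hl, hPl⟩ := exists_label P
    rw [finrank_selfStress_of_mem hl hPl, hf l hl ((hT l hl P hPl).1 hP)]

/-- As a check, the non-collinear entries (first, second, fourth) add up to `3^4 - 2 * 2^4 + 1 = 50`
sign vectors taking both signs. The others add up to `(75 - 1) / 2 + 1 = 38`, the 75 weak orders on
four points up to reversal. -/
theorem card_typeIndex : ∀ n : Fin 9,
    (Finset.univ.filter fun l : Label => l.IsValid ∧ l.typeIndex = n).card =
      (![14, 24, 12, 12, 6, 12, 4, 3, 1] : Fin 9 → ℕ) n := by decide +kernel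

theorem card_isTriple : ∀ m : Fin 4,
    (Finset.univ.filter fun l : Label => l.IsValid ∧ l.IsTriple m).card = 6 := by decide +kernel

theorem card_typeDim : ∀ k : Fin 9,
    (Finset.univ.filter fun l : Label => l.IsValid ∧ typeDim l.typeIndex = k).card =
      (![0, 0, 1, 0, 7, 18, 24, 24, 14] : Fin 9 → ℕ) k := by decide +kernel

theorem typeIndex_of_isTriple : ∀ m : Fin 4, ∀ l : Label, l.IsValid → l.IsTriple m →
    l.typeIndex = 1 := by
  decide +kernel

theorem consistsOfStrata_locus (τ : PointPattern) :
    ConsistsOfStrata τ.locus ((![14, 24, 12, 12, 6, 12, 4, 3, 1] : Fin 9 → ℕ) τ.index)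
      (typeDim τ.index) (fiberDim τ.index) :=
  consistsOfStrata_of_label (fun l => l.typeIndex = τ.index)
    (fun _ hl _ hP => mem_locus_iff hl hP τ) (card_typeIndex τ.index) (fun _ _ h => by rw [h])
    fun _ _ h => by rw [h]

theorem consistsOfStrata_collinearTriple (m : Fin 4) :
    ConsistsOfStrata (collinearTriple m) 6 7 1 :=
  consistsOfStrata_of_label (Label.IsTriple m)
    (fun _ hl _ hP => mem_collinearTriple_iff_isTriple hl hP m) (card_isTriple m)
    (fun l hl h => by rw [typeIndex_of_isTriple m l hl h]; rfl)
    fun l hl h => by rw [typeIndex_of_isTriple m l hl h]; rfl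

theorem existsUnique_pattern (P : Configuration (Fin 4) 2) :
    ∃! τ : PointPattern, P ∈ τ.locus := by
  obtain ⟨l, hl, hP⟩ := exists_label P
  obtain ⟨τ, hτ⟩ := PointPattern.index_surjective l.typeIndex
  refine ⟨τ, (mem_locus_iff hl hP τ).2 hτ.symm, fun τ' h => PointPattern.index_injective ?_⟩
  rw [hτ, (mem_locus_iff hl hP τ').1 h]

theorem encard_strata_of_dim (k : Fin 9) :
    {S : Set (Configuration (Fin 4) 2) | IsStratum (⊤ : SimpleGraph (Fin 4)) S ∧
      stratumDim S = ((k : ℕ) : ENNReal)}.encard =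
      (((![0, 0, 1, 0, 7, 18, 24, 24, 14] : Fin 9 → ℕ) k : ℕ) : ℕ∞) := by
  rw [← card_typeDim k]
  refine encard_strata (fun l => typeDim l.typeIndex = k) fun S => ?_
  rw [Set.mem_ofPred_eq, isStratum_iff]
  constructor
  · rintro ⟨⟨l, hl, rfl⟩, h⟩
    rw [stratumDim, dimH_stratum hl, Nat.cast_inj] at h
    exact ⟨l, ⟨hl, h⟩, rfl⟩
  · rintro ⟨l, ⟨hl, h⟩, rfl⟩
    exact ⟨⟨l, hl, rfl⟩, by rw [stratumDim, dimH_stratum hl, h]⟩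

end Tensegrity

theorem mainTheorem2 :
    -- every configuration is of exactly one type
    (∀ P : Tensegrity.Configuration (Fin 4) 2,
      ∃! τ : Tensegrity.PointPattern, P ∈ τ.locus) ∧
    -- number of strata, dimension of the strata, and dimension of the fibers for each type
    Tensegrity.ConsistsOfStrata Tensegrity.PointPattern.generalPosition.locus 14 8 1 ∧
    Tensegrity.ConsistsOfStrata Tensegrity.PointPattern.threeCollinear.locus 24 7 1 ∧
    (∀ l : Fin 4, Tensegrity.ConsistsOfStrata (Tensegrity.collinearTriple l) 6 7 1) ∧
    Tensegrity.ConsistsOfStrata Tensegrity.PointPattern.fourCollinear.locus 12 6 3 ∧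
    Tensegrity.ConsistsOfStrata Tensegrity.PointPattern.onePairCoincides.locus 12 6 1 ∧
    Tensegrity.ConsistsOfStrata Tensegrity.PointPattern.collinearDoubleInMiddle.locus 6 5 3 ∧
    Tensegrity.ConsistsOfStrata Tensegrity.PointPattern.collinearDoubleAtEnd.locus 12 5 3 ∧
    Tensegrity.ConsistsOfStrata Tensegrity.PointPattern.threeCoincide.locus 4 4 3 ∧
    Tensegrity.ConsistsOfStrata Tensegrity.PointPattern.twoPairsCoincide.locus 3 4 3 ∧
    Tensegrity.ConsistsOfStrata Tensegrity.PointPattern.allCoincide.locus 1 2 6 ∧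
    -- the number of strata of dimension `0, ..., 8`
    (∀ k : Fin 9,
      {S : Set (Tensegrity.Configuration (Fin 4) 2) |
        Tensegrity.IsStratum (⊤ : SimpleGraph (Fin 4)) S ∧
          Tensegrity.stratumDim S = ((k : ℕ) : ENNReal)}.encard =
        (((![0, 0, 1, 0, 7, 18, 24, 24, 14] : Fin 9 → ℕ) k : ℕ) : ℕ∞)) := by
  refine ⟨Tensegrity.existsUnique_pattern, ?_, ?_, Tensegrity.consistsOfStrata_collinearTriple,
    ?_, ?_, ?_, ?_, ?_, ?_, ?_, Tensegrity.encard_strata_of_dim⟩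
  exacts [Tensegrity.consistsOfStrata_locus .generalPosition,
    Tensegrity.consistsOfStrata_locus .threeCollinear,
    Tensegrity.consistsOfStrata_locus .fourCollinear,
    Tensegrity.consistsOfStrata_locus .onePairCoincides,
    Tensegrity.consistsOfStrata_locus .collinearDoubleInMiddle,
    Tensegrity.consistsOfStrata_locus .collinearDoubleAtEnd,
    Tensegrity.consistsOfStrata_locus .threeCoincide,
    Tensegrity.consistsOfStrata_locus .twoPairsCoincide,
    Tensegrity.consistsOfStrata_locus .allCoincide]
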